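/- **Setting.** Let $(x_i,y_i)_{i=1}^n$ be data with $x_i\in\mathbb R^d$, $y_i\in[k]$, $k\ge 2$, $n=mb$ with integers $m,b\ge 1$ ($b$ is the batch size), and $\max_i\|x_i\|_1\le R$ for some $R>0$. Assume that the data are linearly separable: some $W\in\mathbb R^{k\times d}$ satisfies $(e_{y_i}-e_c)^\top Wx_i>0$ for all $i$ and all $c\ne y_i$. Let $\|\cdot\|$ be an entry-wise or Schatten $p$-norm on $\mathbb R^{k\times d}$ with $p\in[1,\infty]$, write $\operatorname{mar}(W)=\min_{i,\,c\neq y_i}(e_{y_i}-e_c)^\top Wx_i$, and let $\gamma=\max_{\|W\|\le1}\operatorname{mar}(W)$. Let $\mathcal L(W)=\frac1n\sum_i\ell_i(W)$, where $\ell_i(W)=-\log\frac{\exp((Wx_i)_{y_i})}{\sum_{j}\exp((Wx_i)_j)}$ is the cross-entropy loss, and $\mathcal L_{\mathcal B}(W)=\frac1{|\mathcal B|}\sum_{i\in\mathcal B}\ell_i(W)$ for $\mathcal B\subseteq[n]$. **Algorithm.** In each epoch $e=0,1,2,\dots$ the index set $[n]$ is partitioned into $m$ batches $\mathcal B_{em},\dots,\mathcal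 B_{em+m-1}$ of size $b$ (random reshuffling; everything below holds for every realization of the partitions). Starting from $W_0\in\mathbb R^{k\times d}$, put, with the snapshot $\tilde W_t=W_{m\lfloor t/m\rfloor}$, $$V_t=\nabla\mathcal L_{\mathcal B_t}(W_t)-\nabla\mathcal L_{\mathcal B_t}(\tilde W_t)+\nabla\mathcal L(\tilde W_t),\qquad W_{t+1}=W_t-\eta_t\Delta_t,\qquad \Delta_t\in\arg\max_{\|\Delta\|\le1}\langle H_t,\Delta\rangle ,$$ where $\langle A,B\rangle=\operatorname{tr}(A^\top B)$, any choice of the maximizer is allowed, and either $H_t=V_t$ (without momentum), or $H_t=\beta_1H_{t-1}+(1-\beta_1)V_t$ with $H_{-1}=0$ and $\beta_1\in[0,1)$ (with momentum). The step sizes are $\eta_t=c\,t^{-a}$ for $t\ge1$, with $c>0$, $a\in(0,1]$ and $0\le\eta_0\le c$. **Theorem.** There is a constant $C>0$ that depends only on $a,c,\eta_0,R,\gamma$ (in particular not on $n,m,b,k,d,\beta_1$, the norm, $W_0$, the data beyond $R$ and $\gamma$, or the partitions), and there is a time $t_2\ge 1$ that depends only on $n,b,\beta_1,\gamma,W_0,R$,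 on the step size parameters $a,c,\eta_0$ and on whether momentum is used, such that, for every batch size $b$ and with no condition on $\beta_1\in[0,1)$, for all $t>t_2$ we have $\mathcal L(W_t)\le\frac{\log 2}{n}$, $W_t\neq0$ and $$\gamma-\frac{\operatorname{mar}(W_t)}{\|W_t\|}\le C\cdot\frac{\sum_{s=0}^{t_2-1}\eta_s+C_m\sum_{s=t_2}^{t-1}\eta_s^2+\sum_{s=t_2}^{t-1}\eta_s e^{-\frac\gamma4\sum_{\tau=t_2}^{s-1}\eta_\tau}+C_D}{\sum_{s=0}^{t-1}\eta_s},$$ where $(C_m,C_D)=(m^{2+a},0)$ without momentum and $(C_m,C_D)=\left(\frac{m^{2+a}}{1-\beta_1},D\right)$ with momentum, $D=\frac{4R\eta_0}{1-\sqrt{\beta_1}}$. Moreover the full-batch maximum margin is recovered: $\lim_{t\to\infty}\operatorname{mar}(W_t)/\|W_t\|=\gamma$. -/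

import Mathlib

open scoped ENNReal

noncomputable section

/-- The entry-wise `p`-norm of a real matrix, `p ∈ [1, ∞]`: the `ℓ_p` norm of the family of its
entries (the largest absolute value of an entry for `p = ∞`). -/
def entrywiseNorm {k d : ℕ} (p : ℝ≥0∞) (A : Matrix (Fin k) (Fin d) ℝ) : ℝ :=
  ‖(WithLp.toLp p (fun q : Fin k × Fin d => A q.1 q.2) : PiLp p (fun _ : Fin k × Fin d => ℝ))‖

/-- The Schatten `p`-norm of a real matrix, `p ∈ [1, ∞]`: the `ℓ_p` norm of its singular values.
The singular values of a `k × d` matrix with index `≥ d` are zero, and zeros do not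
contribute to the norm. -/
def schattenNorm {k d : ℕ} (p : ℝ≥0∞) (A : Matrix (Fin k) (Fin d) ℝ) : ℝ :=
  ‖(WithLp.toLp p (fun j : Fin d => (Matrix.toEuclideanLin A).singularValues (j : ℕ)) :
    PiLp p (fun _ : Fin d => ℝ))‖

/-- The two families of matrix norms under consideration. -/
inductive MatrixNormFamily
  | entrywise
  | schatten

/-- The entry-wise or Schatten `p`-norm. -/
def matrixNorm {k d : ℕ} (F : MatrixNormFamily) (p : ℝ≥0∞) (A : Matrix (Fin k) (Fin d) ℝ) : ℝ :=
  match F with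
  | .entrywise => entrywiseNorm p A
  | .schatten => schattenNorm p A

/-- The standard inner product `⟨A, B⟩ = tr (Aᵀ B)` of matrices. -/
def matrixInner {k d : ℕ} (A B : Matrix (Fin k) (Fin d) ℝ) : ℝ := (A.transpose * B).trace

/-- The softmax map `𝕊_c(v) = exp(v_c) / ∑_j exp(v_j)`. -/
def softmaxProb {k : ℕ} (v : Fin k → ℝ) (c : Fin k) : ℝ := Real.exp (v c) / ∑ j, Real.exp (v j)

/-- The cross-entropy loss `-log 𝕊_y(W x)` of a linear classifier at one data point. -/
def sampleLoss {k d : ℕ} (x : Fin d → ℝ) (y : Fin k) (W : Matrix (Fin k) (Fin d) ℝ) : ℝ :=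
  -Real.log (softmaxProb (W.mulVec x) y)

/-- The mini-batch loss: the mean of the losses over the data points with index in `S`. -/
def batchLoss {n k d : ℕ} (x : Fin n → Fin d → ℝ) (y : Fin n → Fin k) (S : Finset (Fin n))
    (W : Matrix (Fin k) (Fin d) ℝ) : ℝ :=
  (1 / (S.card : ℝ)) * ∑ i ∈ S, sampleLoss (x i) (y i) W

/-- The empirical loss `(1/n) ∑ i, ℓ(W xᵢ; yᵢ)`. -/
def empiricalLoss {n k d : ℕ} (x : Fin n → Fin d → ℝ) (y : Fin n → Fin k)
    (W : Matrix (Fin k) (Fin d) ℝ) : ℝ :=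
  (1 / (n : ℝ)) * ∑ i, sampleLoss (x i) (y i) W

/-- The gradient of a function of a matrix: the matrix of its partial derivatives with respect to
the entries. -/
def matrixGradient {k d : ℕ} (f : Matrix (Fin k) (Fin d) ℝ → ℝ) (W : Matrix (Fin k) (Fin d) ℝ) :
    Matrix (Fin k) (Fin d) ℝ :=
  Matrix.of fun c j => lineDeriv ℝ f W (Matrix.single c j 1)

/-- The (unnormalized) margin `min_{i, c ≠ yᵢ} (e_{yᵢ} - e_c)ᵀ W xᵢ` of `W` on the data. -/
def minMargin {n k d : ℕ} (x : Fin n → Fin d → ℝ) (y : Fin n → Fin k)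
    (W : Matrix (Fin k) (Fin d) ℝ) : ℝ :=
  ⨅ q : {q : Fin n × Fin k // q.2 ≠ y q.1},
    (W.mulVec (x q.1.1) (y q.1.1) - W.mulVec (x q.1.1) q.1.2)

/-- The maximum margin `γ = max_{‖W‖ ≤ 1} min_{i, c ≠ yᵢ} (e_{yᵢ} - e_c)ᵀ W xᵢ` of the data with
respect to the norm `N`. -/
def maxMargin {n k d : ℕ} (N : Matrix (Fin k) (Fin d) ℝ → ℝ) (x : Fin n → Fin d → ℝ)
    (y : Fin n → Fin k) : ℝ :=
  sSup (minMargin x y '' {W | N W ≤ 1})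

/-- The data are linearly separable. -/
def LinearlySeparable {n k d : ℕ} (x : Fin n → Fin d → ℝ) (y : Fin n → Fin k) : Prop :=
  ∃ W : Matrix (Fin k) (Fin d) ℝ, ∀ i, ∀ c, c ≠ y i →
    0 < W.mulVec (x i) (y i) - W.mulVec (x i) c

/-- `B t` is the mini-batch of iteration `t`. Epoch `e` consists of the iterations `t` with
`t / m = e`, that is `t = e m + j` with `0 ≤ j < m`. The batches have size `b`, and those of each
epoch partition the data. -/
def IsReshuffling {n : ℕ} (m b : ℕ) (B : ℕ → Finset (Fin n)) : Prop :=
  (∀ t, (B t).card = b) ∧ ∀ e : ℕ, ∀ i : Fin n, ∃! t : ℕ, t / m = e ∧ i ∈ B t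

/-- The variance-reduced gradient estimator
`V_t = ∇L_{B_t}(W_t) - ∇L_{B_t}(W̃_t) + ∇L(W̃_t)`, where the snapshot `W̃_t = W_{m ⌊t/m⌋}` is the
iterate at the beginning of the epoch of `t`. -/
def vrEstimator {n k d : ℕ} (x : Fin n → Fin d → ℝ) (y : Fin n → Fin k) (m : ℕ)
    (B : ℕ → Finset (Fin n)) (W : ℕ → Matrix (Fin k) (Fin d) ℝ) (t : ℕ) :
    Matrix (Fin k) (Fin d) ℝ :=
  matrixGradient (batchLoss x y (B t)) (W t)
    - matrixGradient (batchLoss x y (B t)) (W (m * (t / m)))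
    + matrixGradient (empiricalLoss x y) (W (m * (t / m)))

/-- The exponential moving average `M_t = β M_{t-1} + (1 - β) V_t` with `M_{-1} = 0`. -/
def momentumBuffer {k d : ℕ} (β : ℝ) (V : ℕ → Matrix (Fin k) (Fin d) ℝ) :
    ℕ → Matrix (Fin k) (Fin d) ℝ
  | 0 => (1 - β) • V 0
  | t + 1 => β • momentumBuffer β V t + (1 - β) • V (t + 1)

/-- The signal that drives the descent: the buffer of the `V_t` with momentum,
`V_t` itself without. -/
def descentSignal {k d : ℕ} (momentum : Bool) (β : ℝ) (V : ℕ → Matrix (Fin k) (Fin d) ℝ) (t : ℕ) :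
    Matrix (Fin k) (Fin d) ℝ :=
  if momentum then momentumBuffer β V t else V t

/-- `Δ` is a steepest descent direction of `G`, i.e. a maximizer of `⟨G, ·⟩` on the unit ball of
the norm `N` (any maximizer is allowed). -/
def IsSteepestDirection {k d : ℕ} (N : Matrix (Fin k) (Fin d) ℝ → ℝ)
    (G Δ : Matrix (Fin k) (Fin d) ℝ) : Prop :=
  N Δ ≤ 1 ∧ ∀ Δ' : Matrix (Fin k) (Fin d) ℝ, N Δ' ≤ 1 → matrixInner G Δ' ≤ matrixInner G Δ

/-- `W` is a sequence of iterates of variance-reduced stochastic steepest descent with step sizes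
`η` and mini-batches `B`, with or without momentum. -/
def IsVRSteepestDescent {n k d : ℕ} (N : Matrix (Fin k) (Fin d) ℝ → ℝ) (x : Fin n → Fin d → ℝ)
    (y : Fin n → Fin k) (m : ℕ) (B : ℕ → Finset (Fin n)) (η : ℕ → ℝ) (momentum : Bool) (β : ℝ)
    (W : ℕ → Matrix (Fin k) (Fin d) ℝ) : Prop :=
  ∀ t, ∃ Δ : Matrix (Fin k) (Fin d) ℝ,
    IsSteepestDirection N (descentSignal momentum β (vrEstimator x y m B W) t) Δ ∧
    W (t + 1) = W t - η t • Δ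

/-- The step sizes `η_t = c t^{-a}` for `t ≥ 1`, with a separate value `η₀` at `t = 0`. -/
def stepSize (a c η₀ : ℝ) (t : ℕ) : ℝ := if t = 0 then η₀ else c * (t : ℝ) ^ (-a)

/-- The coefficient `C_m`. -/
def noiseCoeff (momentum : Bool) (a β : ℝ) (m : ℕ) : ℝ :=
  if momentum then (m : ℝ) ^ (2 + a) / (1 - β) else (m : ℝ) ^ (2 + a)

/-- The constant `C_D`. -/
def driftConst (momentum : Bool) (R η₀ β : ℝ) : ℝ :=
  if momentum then 4 * R * η₀ / (1 - Real.sqrt β) else 0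

end

/-! Every error is measured relative to the mean error probability `meanError`, written G, instead
of in absolute terms. Moving the logits by δ changes each softmax probability by a factor of at most
exp(2δ), so a gradient moved along a path of length δ changes by O(exp(2Rδ) - 1) G. A batch has mean
error at most m G. Hence the variance-reduced gradient has relative error O(m² η_t), and the
momentum buffer O(m² η_t / (1 - β)) once its initial bias has died out geometrically. No condition
on b or β is needed, because the relative error tends to 0 with the step size
(`eventually_signalError_le`).

A steepest direction for a signal of relative error ε still satisfies ⟨∇L, Δ⟩ ≥ (γ - 2ε) G
(`matrixInner_steepest_ge`), so eventually L decreases by η_t (γ - κ η_t) G. Telescoping forces G,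
and then L, below any threshold (`loss_le_of_window`). Once n L is small, L (1 - n L) ≤ G ≤ L, and
the recursion integrates to exponential decay of L at the sharp rate γ (`loss_decay`). A small loss
bounds the margin below by -log(2 n L), while the norm grows by at most η_t per step; comparing the
two gives the rate.

The norm enters only through `IsEntryNorm`: it dominates every entry and is dominated by the sum of
the absolute entries. This makes all constants independent of the norm and the dimensions. -/

/-! ### Entry-wise norms. -/

/-- A norm on matrices that lies between the largest entry and the sum of the entries in
absolute value. -/
structure IsEntryNorm {k d : ℕ} (N : Matrix (Fin k) (Fin d) ℝ → ℝ) : Prop where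
  add_le : ∀ A B, N (A + B) ≤ N A + N B
  smul : ∀ (r : ℝ) A, N (r • A) = |r| * N A
  abs_entry_le : ∀ A i j, |A i j| ≤ N A
  le_sum : ∀ A, N A ≤ ∑ i, ∑ j, |A i j|

lemma norm_toLp_le_sum_abs {ι : Type*} [Fintype ι] (p : ℝ≥0∞) [Fact (1 ≤ p)] (f : ι → ℝ) :
    ‖(WithLp.toLp p f : PiLp p (fun _ : ι => ℝ))‖ ≤ ∑ i, |f i| := by
  classical
  have h : (WithLp.toLp p f : PiLp p (fun _ : ι => ℝ))
      = ∑ i, WithLp.toLp p (Pi.single i (f i)) := by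
    rw [← WithLp.toLp_sum, Finset.univ_sum_single]
  rw [h]
  refine (norm_sum_le _ _).trans (Finset.sum_le_sum fun i _ => ?_)
  exact (PiLp.norm_single p (fun _ : ι => ℝ) i (f i)).le

lemma isEntryNorm_entrywiseNorm {k d : ℕ} {p : ℝ≥0∞} (hp : 1 ≤ p) :
    IsEntryNorm (entrywiseNorm (k := k) (d := d) p) := by
  have : Fact (1 ≤ p) := ⟨hp⟩
  refine ⟨fun A B => ?_, fun r A => ?_, fun A i j => ?_, fun A => ?_⟩
  · exact norm_add_le (WithLp.toLp p (fun q : Fin k × Fin d => A q.1 q.2) :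
      PiLp p (fun _ : Fin k × Fin d => ℝ)) (WithLp.toLp p (fun q : Fin k × Fin d => B q.1 q.2))
  · exact norm_smul r (WithLp.toLp p (fun q : Fin k × Fin d => A q.1 q.2) :
      PiLp p (fun _ : Fin k × Fin d => ℝ))
  · exact PiLp.norm_apply_le (WithLp.toLp p (fun q : Fin k × Fin d => A q.1 q.2) :
      PiLp p (fun _ : Fin k × Fin d => ℝ)) (i, j)
  · refine (norm_toLp_le_sum_abs p _).trans ?_
    rw [Fintype.sum_prod_type]

/-! ### Bessel's inequality and substochastic contractions. -/

section SubOrthonormal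

variable {E F ι κ : Type*} [NormedAddCommGroup E] [InnerProductSpace ℝ E]
  [NormedAddCommGroup F] [InnerProductSpace ℝ F] [Fintype ι] [Fintype κ]

/-- A pairwise orthogonal family of vectors of norm at most one. -/
structure SubOrthonormal (v : ι → E) : Prop where
  norm_le : ∀ i, ‖v i‖ ≤ 1
  orthogonal : ∀ i j, i ≠ j → inner ℝ (v i) (v j) = 0

/-- Bessel's inequality. -/
lemma SubOrthonormal.sum_inner_sq_le {v : ι → E} (hv : SubOrthonormal v) (w : E) :
    ∑ i, (inner ℝ (v i) w) ^ 2 ≤ ‖w‖ ^ 2 := by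
  classical
  have h1 : inner ℝ w (∑ i, inner ℝ (v i) w • v i) = ∑ i, (inner ℝ (v i) w) ^ 2 := by
    rw [inner_sum]
    refine Finset.sum_congr rfl fun i _ => ?_
    rw [inner_smul_right, real_inner_comm, sq]
  have h2 : ‖∑ i, inner ℝ (v i) w • v i‖ ^ 2 ≤ ∑ i, (inner ℝ (v i) w) ^ 2 := by
    rw [← real_inner_self_eq_norm_sq, sum_inner]
    refine Finset.sum_le_sum fun i _ => ?_
    rw [inner_sum, Finset.sum_eq_single i]
    · rw [inner_smul_left, inner_smul_right, real_inner_self_eq_norm_sq]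
      have := hv.norm_le i
      have h3 : ‖v i‖ ^ 2 ≤ 1 := pow_le_one₀ (norm_nonneg _) this
      simp only [conj_trivial]
      nlinarith [mul_le_mul_of_nonneg_left h3 (sq_nonneg (inner ℝ (v i) w))]
    · intro j _ hj
      rw [inner_smul_left, inner_smul_right, hv.orthogonal i j hj.symm]
      simp
    · simp
  have h3 := norm_sub_sq_real w (∑ i, inner ℝ (v i) w • v i)
  rw [h1] at h3
  nlinarith [sq_nonneg ‖w - ∑ i, inner ℝ (v i) w • v i‖]

/-- AM-GM and Bessel on each side. This supplies both the row and the column sums of the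
substochastic matrix behind the Schatten norms. -/
lemma SubOrthonormal.sum_abs_inner_mul_le {u : ι → E} {v : ι → F} (hu : SubOrthonormal u)
    (hv : SubOrthonormal v) {a : E} {b : F} (ha : ‖a‖ ≤ 1) (hb : ‖b‖ ≤ 1) :
    ∑ i, |inner ℝ (u i) a| * |inner ℝ (v i) b| ≤ 1 := by
  have h1 : ∑ i, (inner ℝ (u i) a) ^ 2 ≤ 1 :=
    (hu.sum_inner_sq_le a).trans (pow_le_one₀ (norm_nonneg _) ha)
  have h2 : ∑ i, (inner ℝ (v i) b) ^ 2 ≤ 1 :=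
    (hv.sum_inner_sq_le b).trans (pow_le_one₀ (norm_nonneg _) hb)
  calc ∑ i, |inner ℝ (u i) a| * |inner ℝ (v i) b|
      ≤ ∑ i, ((inner ℝ (u i) a) ^ 2 + (inner ℝ (v i) b) ^ 2) / 2 := by
        refine Finset.sum_le_sum fun i _ => ?_
        rw [← sq_abs (inner ℝ (u i) a), ← sq_abs (inner ℝ (v i) b)]
        nlinarith [sq_nonneg (|inner ℝ (u i) a| - |inner ℝ (v i) b|)]
    _ ≤ 1 := by
        rw [← Finset.sum_div, Finset.sum_add_distrib]
        linarith

/-- A doubly substochastic matrix is a contraction for every `ℓ_p` norm. -/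
lemma norm_toLp_le_of_substochastic {p : ℝ≥0∞} (hp : 1 ≤ p) (D : ι → κ → ℝ)
    (hD : ∀ i j, 0 ≤ D i j) (hrow : ∀ i, ∑ j, D i j ≤ 1) (hcol : ∀ j, ∑ i, D i j ≤ 1)
    (f : ι → ℝ) (σ : κ → ℝ) (hσ : ∀ j, 0 ≤ σ j) (hf : ∀ i, |f i| ≤ ∑ j, D i j * σ j) :
    ‖(WithLp.toLp p f : PiLp p (fun _ : ι => ℝ))‖
      ≤ ‖(WithLp.toLp p σ : PiLp p (fun _ : κ => ℝ))‖ := by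
  have : Fact (1 ≤ p) := ⟨hp⟩
  rcases eq_or_ne p ∞ with rfl | hp'
  · rw [PiLp.norm_eq_ciSup]
    refine Real.iSup_le (fun i => ?_) (norm_nonneg _)
    calc |f i| ≤ ∑ j, D i j * σ j := hf i
      _ ≤ ∑ j, D i j * ‖(WithLp.toLp ∞ σ : PiLp ∞ (fun _ : κ => ℝ))‖ := by
          refine Finset.sum_le_sum fun j _ => mul_le_mul_of_nonneg_left ?_ (hD i j)
          exact (le_abs_self _).trans
            (PiLp.norm_apply_le (WithLp.toLp ∞ σ : PiLp ∞ (fun _ : κ => ℝ)) j)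
      _ ≤ ‖(WithLp.toLp ∞ σ : PiLp ∞ (fun _ : κ => ℝ))‖ := by
          rw [← Finset.sum_mul]
          exact mul_le_of_le_one_left (norm_nonneg _) (hrow i)
  · have hq : 1 ≤ p.toReal := by
      have := ENNReal.toReal_mono hp' hp
      simpa using this
    have hq0 : 0 < p.toReal := by linarith
    rw [PiLp.norm_eq_sum hq0, PiLp.norm_eq_sum hq0]
    refine Real.rpow_le_rpow (Finset.sum_nonneg fun i _ => by positivity) ?_ (by positivity)
    calc ∑ i, ‖f i‖ ^ p.toReal ≤ ∑ i, ∑ j, D i j * σ j ^ p.toReal := by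
          refine Finset.sum_le_sum fun i _ => ?_
          have hs : 0 ≤ ∑ j, D i j * σ j ^ p.toReal :=
            Finset.sum_nonneg fun j _ => mul_nonneg (hD i j) (Real.rpow_nonneg (hσ j) _)
          -- Weighted Hölder: the total-weight factor is at most 1 by the row sums. The column sums
          -- enter after the order of summation is exchanged.
          have h1 := Real.inner_le_weight_mul_Lp_of_nonneg Finset.univ hq (D i) σ (hD i) hσ
          have h2 : (∑ j, D i j) ^ (1 - p.toReal⁻¹) ≤ 1 :=
            Real.rpow_le_one (Finset.sum_nonneg fun j _ => hD i j) (hrow i)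
              (sub_nonneg.2 (inv_le_one_of_one_le₀ hq))
          have h3 : ‖f i‖ ≤ (∑ j, D i j * σ j ^ p.toReal) ^ p.toReal⁻¹ :=
            (hf i).trans (h1.trans (mul_le_of_le_one_left (Real.rpow_nonneg hs _) h2))
          calc ‖f i‖ ^ p.toReal ≤ ((∑ j, D i j * σ j ^ p.toReal) ^ p.toReal⁻¹) ^ p.toReal :=
                Real.rpow_le_rpow (norm_nonneg _) h3 hq0.le
            _ = _ := Real.rpow_inv_rpow hs hq0.ne'
      _ = ∑ j, (∑ i, D i j) * σ j ^ p.toReal := by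
          rw [Finset.sum_comm]
          simp_rw [Finset.sum_mul]
      _ ≤ ∑ j, ‖σ j‖ ^ p.toReal := by
          refine Finset.sum_le_sum fun j _ => ?_
          rw [Real.norm_of_nonneg (hσ j)]
          exact mul_le_of_le_one_left (Real.rpow_nonneg (hσ j) _) (hcol j)

end SubOrthonormal

/-! ### Singular values and Schatten norms. -/

section SingularSystem

variable {E F ι : Type*} [NormedAddCommGroup E] [InnerProductSpace ℝ E]
  [NormedAddCommGroup F] [InnerProductSpace ℝ F] [Fintype ι]

lemma OrthonormalBasis.subOrthonormal (u : OrthonormalBasis ι ℝ E) : SubOrthonormal u :=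
  ⟨fun i => (u.orthonormal.1 i).le, fun _ _ h => u.orthonormal.2 h⟩

variable [FiniteDimensional ℝ E] [FiniteDimensional ℝ F]

/-- Singular value decomposition. -/
lemma exists_singular_system (T : E →ₗ[ℝ] F) {n : ℕ} (hn : Module.finrank ℝ E = n) :
    ∃ (u : OrthonormalBasis (Fin n) ℝ E) (v : Fin n → F), SubOrthonormal v ∧
      (∀ j, T (u j) = T.singularValues (j : ℕ) • v j) ∧
      ∀ j, inner ℝ (T (u j)) (v j) = T.singularValues (j : ℕ) := by
  set u := T.isSymmetric_adjoint_comp_self.eigenvectorBasis hn with hu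
  set σ : Fin n → ℝ := fun j => T.singularValues (j : ℕ) with hσ
  have hT : ∀ i j, inner ℝ (T (u i)) (T (u j)) = if i = j then σ i ^ 2 else 0 := by
    intro i j
    rw [← LinearMap.adjoint_inner_left]
    have h := T.isSymmetric_adjoint_comp_self.apply_eigenvectorBasis hn i
    rw [LinearMap.comp_apply, ← hu] at h
    rw [h, inner_smul_left, orthonormal_iff_ite.1 u.orthonormal i j]
    simp only [hσ, T.sq_singularValues_fin hn i]
    split_ifs <;> simp
  have hzero : ∀ j, σ j = 0 → T (u j) = 0 := fun j hj => by
    have := hT j j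
    rw [if_pos rfl, hj] at this
    simpa using this
  have hself : ∀ j, inner ℝ (T (u j)) ((σ j)⁻¹ • T (u j)) = σ j := by
    intro j
    rw [inner_smul_right, hT, if_pos rfl]
    by_cases h : σ j = 0
    · simp [h]
    · field_simp
  -- Since `0⁻¹ = 0`, the left vector is zero where the singular value vanishes; hence
  -- `SubOrthonormal` rather than orthonormal.
  refine ⟨u, fun j => (σ j)⁻¹ • T (u j), ⟨fun j => ?_, fun i j hij => ?_⟩, fun j => ?_, hself⟩
  · have h : ‖(σ j)⁻¹ • T (u j)‖ ^ 2 ≤ 1 := by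
      rw [← real_inner_self_eq_norm_sq, inner_smul_left, hself]
      by_cases h : σ j = 0
      · simp [h]
      · simp [h]
    exact (sq_le_one_iff₀ (norm_nonneg _)).1 h
  · rw [inner_smul_left, inner_smul_right, hT, if_neg hij]
    simp
  · by_cases h : σ j = 0
    · change T (u j) = σ j • _
      rw [hzero j h, h, zero_smul]
    · exact (smul_inv_smul₀ h _).symm

/-- The `ℓ_p` norm of the diagonal of an operator with respect to a pair of orthonormal systems
is at most the `ℓ_p` norm of its singular values. -/
lemma norm_toLp_inner_le_singularValues {p : ℝ≥0∞} (hp : 1 ≤ p) (T : E →ₗ[ℝ] F) {n : ℕ}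
    (hn : Module.finrank ℝ E = n) {a : ι → E} {b : ι → F} (ha : SubOrthonormal a)
    (hb : SubOrthonormal b) :
    ‖(WithLp.toLp p (fun i => inner ℝ (T (a i)) (b i)) : PiLp p (fun _ : ι => ℝ))‖
      ≤ ‖(WithLp.toLp p (fun j : Fin n => T.singularValues (j : ℕ)) :
        PiLp p (fun _ : Fin n => ℝ))‖ := by
  obtain ⟨u, v, hv, hTu, -⟩ := exists_singular_system T hn
  -- Expanding in the singular basis writes the diagonal as this matrix applied to the singular
  -- values. Bessel for u, v bounds the rows and Bessel for a, b the columns.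
  refine norm_toLp_le_of_substochastic hp
    (fun i j => |inner ℝ (u j) (a i)| * |inner ℝ (v j) (b i)|)
    (fun i j => by positivity) (fun i => ?_) (fun j => ?_) _ _
    (fun j => T.singularValues_nonneg _) (fun i => ?_)
  · exact u.subOrthonormal.sum_abs_inner_mul_le hv (ha.norm_le i) (hb.norm_le i)
  · simp_rw [real_inner_comm]
    simpa only [real_inner_comm] using ha.sum_abs_inner_mul_le hb
      (u.subOrthonormal.norm_le j) (hv.norm_le j)
  · have h : T (a i) = ∑ j, (inner ℝ (u j) (a i) * T.singularValues (j : ℕ)) • v j := by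
      conv_lhs => rw [← u.sum_repr' (a i)]
      rw [map_sum]
      refine Finset.sum_congr rfl fun j _ => ?_
      rw [map_smul, hTu, smul_smul]
    rw [h, sum_inner]
    refine (Finset.abs_sum_le_sum_abs _ _).trans (Finset.sum_le_sum fun j _ => ?_)
    rw [real_inner_smul_left, abs_mul, abs_mul, abs_of_nonneg (T.singularValues_nonneg _)]
    exact le_of_eq (by ring)

end SingularSystem

/-- Together with `norm_diagonal_le_schattenNorm` this gives a variational formula: the Schatten
norm is the largest ℓ_p norm of a diagonal. The norm axioms then reduce to those of ℓ_p. -/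
lemma schattenNorm_eq_diagonal {k d : ℕ} (p : ℝ≥0∞) (A : Matrix (Fin k) (Fin d) ℝ) :
    ∃ (u : Fin d → EuclideanSpace ℝ (Fin d)) (v : Fin d → EuclideanSpace ℝ (Fin k)),
      SubOrthonormal u ∧ SubOrthonormal v ∧ schattenNorm p A =
        ‖(WithLp.toLp p (fun j => inner ℝ (Matrix.toEuclideanLin A (u j)) (v j)) :
          PiLp p (fun _ : Fin d => ℝ))‖ := by
  obtain ⟨u, v, hv, -, h⟩ := exists_singular_system (Matrix.toEuclideanLin A)
    (finrank_euclideanSpace_fin (𝕜 := ℝ) (n := d))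
  exact ⟨u, v, u.subOrthonormal, hv, by simp_rw [h]; rfl⟩

lemma norm_diagonal_le_schattenNorm {k d : ℕ} {ι : Type*} [Fintype ι] {p : ℝ≥0∞} (hp : 1 ≤ p)
    (A : Matrix (Fin k) (Fin d) ℝ) {u : ι → EuclideanSpace ℝ (Fin d)}
    {v : ι → EuclideanSpace ℝ (Fin k)} (hu : SubOrthonormal u) (hv : SubOrthonormal v) :
    ‖(WithLp.toLp p (fun j => inner ℝ (Matrix.toEuclideanLin A (u j)) (v j)) :
          PiLp p (fun _ : ι => ℝ))‖ ≤ schattenNorm p A :=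
  norm_toLp_inner_le_singularValues hp _ finrank_euclideanSpace_fin hu hv

lemma isEntryNorm_schattenNorm {k d : ℕ} {p : ℝ≥0∞} (hp : 1 ≤ p) :
    IsEntryNorm (schattenNorm (k := k) (d := d) p) := by
  have : Fact (1 ≤ p) := ⟨hp⟩
  have hsmul_le : ∀ (r : ℝ) (A : Matrix (Fin k) (Fin d) ℝ),
      schattenNorm p (r • A) ≤ |r| * schattenNorm p A := by
    intro r A
    obtain ⟨u, v, hu, hv, h⟩ := schattenNorm_eq_diagonal p (r • A)
    rw [h]
    refine le_trans (le_of_eq ?_)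
      (mul_le_mul_of_nonneg_left (norm_diagonal_le_schattenNorm hp A hu hv) (abs_nonneg r))
    rw [← Real.norm_eq_abs, ← norm_smul]
    congr 1
    ext j
    simp [inner_smul_left]
  have hentry : ∀ (A : Matrix (Fin k) (Fin d) ℝ) i j, A i j =
      inner ℝ (Matrix.toEuclideanLin A (EuclideanSpace.single j 1))
        (EuclideanSpace.single i 1) := by
    intro A i j
    simp [EuclideanSpace.inner_single_right, Matrix.toLpLin_apply]
  refine ⟨fun A B => ?_, fun r A => le_antisymm (hsmul_le r A) ?_, fun A i j => ?_, fun A => ?_⟩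
  · obtain ⟨u, v, hu, hv, h⟩ := schattenNorm_eq_diagonal p (A + B)
    rw [h]
    refine le_trans ?_ (add_le_add (norm_diagonal_le_schattenNorm hp A hu hv)
      (norm_diagonal_le_schattenNorm hp B hu hv))
    refine le_trans (le_of_eq ?_) (norm_add_le _ _)
    congr 1
    ext j
    simp [inner_add_left]
  · rcases eq_or_ne r 0 with rfl | hr
    · simp [schattenNorm]
    · have h := hsmul_le r⁻¹ (r • A)
      rw [inv_smul_smul₀ hr, abs_inv] at h
      have hr' : 0 < |r| := abs_pos.2 hr
      calc |r| * schattenNorm p A ≤ |r| * (|r|⁻¹ * schattenNorm p (r • A)) := by gcongr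
        _ = _ := by field_simp
  -- An entry is a diagonal of length one, for two standard basis vectors.
  · have h := norm_diagonal_le_schattenNorm (ι := Unit) hp A
      (u := fun _ => EuclideanSpace.single j 1) (v := fun _ => EuclideanSpace.single i 1)
      ⟨by simp, fun a b hab => (hab rfl).elim⟩ ⟨by simp, fun a b hab => (hab rfl).elim⟩
    refine le_trans ?_ h
    refine le_trans (le_of_eq ?_) (PiLp.norm_apply_le _ ())
    exact congrArg abs (hentry A i j)
  · obtain ⟨u, v, hu, hv, h⟩ := schattenNorm_eq_diagonal p A
    rw [h]
    refine (norm_toLp_le_sum_abs p _).trans ?_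
    have hexp : ∀ l, |inner ℝ (Matrix.toEuclideanLin A (u l)) (v l)| ≤
        ∑ i, ∑ j, |A i j| * (|inner ℝ (u l) (EuclideanSpace.single j (1 : ℝ))| *
          |inner ℝ (v l) (EuclideanSpace.single i (1 : ℝ))|) := by
      intro l
      have : inner ℝ (Matrix.toEuclideanLin A (u l)) (v l) =
          ∑ i, ∑ j, A i j * (u l j * v l i) := by
        simp only [PiLp.inner_apply, Matrix.toLpLin_apply, Matrix.mulVec, dotProduct,
          RCLike.inner_apply, conj_trivial, Finset.mul_sum]
        refine Finset.sum_congr rfl fun i _ => Finset.sum_congr rfl fun j _ => by ring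
      rw [this]
      refine (Finset.abs_sum_le_sum_abs _ _).trans (Finset.sum_le_sum fun i _ => ?_)
      refine (Finset.abs_sum_le_sum_abs _ _).trans (Finset.sum_le_sum fun j _ => ?_)
      simp [EuclideanSpace.inner_single_right, abs_mul]
    refine (Finset.sum_le_sum fun l _ => hexp l).trans ?_
    rw [Finset.sum_comm]
    refine Finset.sum_le_sum fun i _ => ?_
    rw [Finset.sum_comm]
    refine Finset.sum_le_sum fun j _ => ?_
    rw [← Finset.mul_sum]
    refine mul_le_of_le_one_right (abs_nonneg _) ?_
    exact hu.sum_abs_inner_mul_le hv (by simp) (by simp)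

lemma isEntryNorm_matrixNorm {k d : ℕ} (F : MatrixNormFamily) {p : ℝ≥0∞} (hp : 1 ≤ p) :
    IsEntryNorm (matrixNorm (k := k) (d := d) F p) := by
  cases F
  · exact isEntryNorm_entrywiseNorm hp
  · exact isEntryNorm_schattenNorm hp

/-! ### Multiplicative stability of softmax and cross-entropy estimates. -/

section Softmax

variable {k : ℕ} (v v' : Fin k → ℝ)

lemma sum_exp_pos (y : Fin k) : 0 < ∑ j, Real.exp (v j) :=
  Finset.sum_pos (fun _ _ => Real.exp_pos _) ⟨y, Finset.mem_univ y⟩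

lemma softmaxProb_pos (c : Fin k) : 0 < softmaxProb v c :=
  div_pos (Real.exp_pos _) (sum_exp_pos v c)

lemma sum_softmaxProb (y : Fin k) : ∑ c, softmaxProb v c = 1 := by
  unfold softmaxProb
  rw [← Finset.sum_div, div_self (sum_exp_pos v y).ne']

lemma one_sub_softmaxProb (y : Fin k) :
    1 - softmaxProb v y = ∑ c ∈ Finset.univ.erase y, softmaxProb v c := by
  rw [← sum_softmaxProb v y, ← Finset.add_sum_erase _ _ (Finset.mem_univ y)]
  ring

lemma softmaxProb_le_one (y : Fin k) : softmaxProb v y ≤ 1 := by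
  have h := one_sub_softmaxProb v y
  have : 0 ≤ ∑ c ∈ Finset.univ.erase y, softmaxProb v c :=
    Finset.sum_nonneg fun c _ => (softmaxProb_pos v c).le
  linarith

lemma softmaxProb_lt_one {y c : Fin k} (h : c ≠ y) : softmaxProb v y < 1 := by
  have h' := one_sub_softmaxProb v y
  have : 0 < ∑ c ∈ Finset.univ.erase y, softmaxProb v c :=
    Finset.sum_pos (fun c _ => softmaxProb_pos v c) ⟨c, by simp [h]⟩
  linarith

lemma inv_softmaxProb (y : Fin k) : (softmaxProb v y)⁻¹ = ∑ c, Real.exp (v c - v y) := by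
  simp_rw [softmaxProb, inv_div, Real.exp_sub, Finset.sum_div]

variable {v v'} {δ : ℝ}

/-- The numerator and the denominator each change by a factor of at most exp(δ). -/
lemma softmaxProb_le_exp_mul (h : ∀ c, |v' c - v c| ≤ δ) (c : Fin k) :
    softmaxProb v' c ≤ Real.exp (2 * δ) * softmaxProb v c := by
  have h1 : Real.exp (v' c) ≤ Real.exp δ * Real.exp (v c) := by
    rw [← Real.exp_add]
    exact Real.exp_le_exp.2 (by linarith [(abs_le.1 (h c)).2])
  have h2 : ∑ j, Real.exp (v j) ≤ Real.exp δ * ∑ j, Real.exp (v' j) := by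
    rw [Finset.mul_sum]
    refine Finset.sum_le_sum fun j _ => ?_
    rw [← Real.exp_add]
    exact Real.exp_le_exp.2 (by linarith [(abs_le.1 (h j)).1])
  have p1 := sum_exp_pos v c
  have p2 := sum_exp_pos v' c
  unfold softmaxProb
  rw [← mul_div_assoc, div_le_div_iff₀ p2 p1, two_mul, Real.exp_add]
  calc _ ≤ (Real.exp δ * Real.exp (v c)) * (Real.exp δ * ∑ j, Real.exp (v' j)) := by gcongr
    _ = _ := by ring

lemma abs_softmaxProb_sub_le (h : ∀ c, |v' c - v c| ≤ δ) (c : Fin k) :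
    |softmaxProb v' c - softmaxProb v c| ≤ (Real.exp (2 * δ) - 1) * softmaxProb v c := by
  have h1 := softmaxProb_le_exp_mul h c
  have h2 := softmaxProb_le_exp_mul (v := v') (v' := v) (δ := δ)
    (fun c => by rw [abs_sub_comm]; exact h c) c
  have p := softmaxProb_pos v c
  have p' := softmaxProb_pos v' c
  have hδ : 0 ≤ δ := (abs_nonneg _).trans (h c)
  have he : 1 ≤ Real.exp (2 * δ) := Real.one_le_exp (by linarith)
  rw [abs_le]
  constructor
  -- If the probability drops, the drop is at most (exp(2δ) - 1) times the new, smaller probability.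
  · by_cases hlt : softmaxProb v c ≤ softmaxProb v' c
    · nlinarith
    · nlinarith [not_le.1 hlt]
  · nlinarith

lemma one_sub_softmaxProb_le_exp_mul (h : ∀ c, |v' c - v c| ≤ δ) (y : Fin k) :
    1 - softmaxProb v' y ≤ Real.exp (2 * δ) * (1 - softmaxProb v y) := by
  rw [one_sub_softmaxProb, one_sub_softmaxProb, Finset.mul_sum]
  exact Finset.sum_le_sum fun c _ => softmaxProb_le_exp_mul h c

/-- The change at the label is minus the sum of the other changes, which costs the factor 2. The
resulting factor 1 - p_y is what makes gradient errors relative to `meanError`. -/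
lemma sum_abs_softmaxProb_sub_le (h : ∀ c, |v' c - v c| ≤ δ) (y : Fin k) :
    ∑ c, |softmaxProb v' c - softmaxProb v c|
      ≤ 2 * (Real.exp (2 * δ) - 1) * (1 - softmaxProb v y) := by
  have h1 : ∑ c ∈ Finset.univ.erase y, |softmaxProb v' c - softmaxProb v c|
      ≤ (Real.exp (2 * δ) - 1) * (1 - softmaxProb v y) := by
    rw [one_sub_softmaxProb v y, Finset.mul_sum]
    exact Finset.sum_le_sum fun c _ => abs_softmaxProb_sub_le h c
  have h2 : |softmaxProb v' y - softmaxProb v y|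
      ≤ ∑ c ∈ Finset.univ.erase y, |softmaxProb v' c - softmaxProb v c| := by
    have : softmaxProb v' y - softmaxProb v y
        = -∑ c ∈ Finset.univ.erase y, (softmaxProb v' c - softmaxProb v c) := by
      rw [Finset.sum_sub_distrib, ← one_sub_softmaxProb, ← one_sub_softmaxProb]
      ring
    rw [this, abs_neg]
    exact Finset.abs_sum_le_sum_abs _ _
  rw [← Finset.add_sum_erase _ _ (Finset.mem_univ y)]
  linarith

lemma sum_abs_softmaxProb_sub_indicator (v : Fin k → ℝ) (y : Fin k) :
    ∑ c, |softmaxProb v c - if c = y then 1 else 0| = 2 * (1 - softmaxProb v y) := by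
  rw [← Finset.add_sum_erase _ _ (Finset.mem_univ y), if_pos rfl, abs_sub_comm,
    abs_of_nonneg (sub_nonneg.2 (softmaxProb_le_one v y)), two_mul]
  congr 1
  rw [one_sub_softmaxProb]
  refine Finset.sum_congr rfl fun c hc => ?_
  rw [if_neg (Finset.ne_of_mem_erase hc), sub_zero, abs_of_pos (softmaxProb_pos v c)]

lemma sum_softmaxProb_sub_indicator_mul (v w : Fin k → ℝ) (y : Fin k) :
    ∑ c, (softmaxProb v c - if c = y then 1 else 0) * w c
      = ∑ c, softmaxProb v c * (w c - w y) := by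
  simp only [sub_mul, mul_sub, Finset.sum_sub_distrib, ← Finset.sum_mul, sum_softmaxProb v y]
  simp

/-- Apply exp(u) - 1 ≤ u exp(u), then bound the remaining u (exp(u) - 1) separately for each sign of
u. -/
lemma exp_sub_one_le (u : ℝ) : Real.exp u - 1 ≤ u + u ^ 2 * Real.exp |u| := by
  have h1 : 1 - Real.exp (-u) ≤ u := by linarith [Real.add_one_le_exp (-u)]
  have h2 : Real.exp u - 1 ≤ u * Real.exp u := by
    have := mul_le_mul_of_nonneg_right h1 (Real.exp_pos u).le
    rwa [sub_mul, ← Real.exp_add, neg_add_cancel, Real.exp_zero, one_mul] at this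
  rcases le_total 0 u with hu | hu
  · rw [abs_of_nonneg hu]
    nlinarith [mul_le_mul_of_nonneg_left h2 hu]
  · have h3 : 1 ≤ Real.exp |u| := Real.one_le_exp (abs_nonneg u)
    nlinarith [mul_le_mul_of_nonpos_left (Real.add_one_le_exp u) hu,
      mul_le_mul_of_nonneg_left h3 (sq_nonneg u)]

/-- Second-order upper bound for the cross-entropy. -/
lemma neg_log_softmaxProb_le (h : ∀ c, |v' c - v c| ≤ δ) (y : Fin k) :
    -Real.log (softmaxProb v' y) ≤ -Real.log (softmaxProb v y)
      + ∑ c, (softmaxProb v c - if c = y then 1 else 0) * (v' c - v c)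
      + 4 * δ ^ 2 * Real.exp (2 * δ) * (1 - softmaxProb v y) := by
  have p := softmaxProb_pos v y
  have p' := softmaxProb_pos v' y
  have hδ : 0 ≤ δ := (abs_nonneg _).trans (h y)
  -- Centring at the label's logit kills the term c = y, so the quadratic remainder carries the
  -- factor 1 - p_y. It also doubles the range of u, hence the 4 δ².
  set u : Fin k → ℝ := fun c => (v' c - v c) - (v' y - v y) with hu
  have hratio : softmaxProb v y / softmaxProb v' y = ∑ c, softmaxProb v c * Real.exp (u c) := by
    rw [div_eq_mul_inv, inv_softmaxProb, Finset.mul_sum]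
    refine Finset.sum_congr rfl fun c _ => ?_
    have q := sum_exp_pos v y
    simp only [softmaxProb, hu, div_mul_eq_mul_div, ← Real.exp_add]
    ring_nf
  have hlog : Real.log (softmaxProb v y) - Real.log (softmaxProb v' y)
      ≤ ∑ c, softmaxProb v c * Real.exp (u c) - 1 := by
    rw [← Real.log_div p.ne' p'.ne', hratio]
    exact Real.log_le_sub_one_of_pos (hratio ▸ div_pos p p')
  have hsum : ∑ c, softmaxProb v c * Real.exp (u c) - 1
      = ∑ c, softmaxProb v c * (Real.exp (u c) - 1) := by
    simp only [mul_sub, mul_one, Finset.sum_sub_distrib, sum_softmaxProb v y]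
  have hbd : ∑ c, softmaxProb v c * (Real.exp (u c) - 1)
      ≤ ∑ c, softmaxProb v c * u c
        + 4 * δ ^ 2 * Real.exp (2 * δ) * (1 - softmaxProb v y) := by
    rw [one_sub_softmaxProb, ← Finset.add_sum_erase _ _ (Finset.mem_univ y),
      ← Finset.add_sum_erase (a := y) _ (fun c => softmaxProb v c * u c) (Finset.mem_univ y)]
    have hy : u y = 0 := by simp [hu]
    rw [hy, Finset.mul_sum]
    simp only [Real.exp_zero, sub_self, mul_zero, zero_add]
    rw [← Finset.sum_add_distrib]
    refine Finset.sum_le_sum fun c _ => ?_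
    have huc : |u c| ≤ 2 * δ := by
      refine (abs_sub _ _).trans ?_
      linarith [h c, h y]
    have h1 := exp_sub_one_le (u c)
    have h2 : (u c) ^ 2 * Real.exp |u c| ≤ (2 * δ) ^ 2 * Real.exp (2 * δ) := by
      rw [← sq_abs]
      gcongr
    have h3 := mul_le_mul_of_nonneg_left (h1.trans (add_le_add_right h2 _))
      (softmaxProb_pos v c).le
    linarith
  have := sum_softmaxProb_sub_indicator_mul v (fun c => v' c - v c) y
  rw [this]
  simp only [hu] at hbd
  linarith

lemma one_sub_softmaxProb_le_neg_log (v : Fin k → ℝ) (y : Fin k) :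
    1 - softmaxProb v y ≤ -Real.log (softmaxProb v y) := by
  linarith [Real.log_le_sub_one_of_pos (softmaxProb_pos v y)]

lemma neg_log_softmaxProb_le_two_mul {y : Fin k} (h : 1 / 2 ≤ softmaxProb v y) :
    -Real.log (softmaxProb v y) ≤ 2 * (1 - softmaxProb v y) := by
  have p := softmaxProb_pos v y
  have h1 := Real.one_sub_inv_le_log_of_pos p
  have h2 : (softmaxProb v y)⁻¹ - 1 ≤ 2 * (1 - softmaxProb v y) := by
    rw [inv_eq_one_div, div_sub_one p.ne', div_le_iff₀ p]
    nlinarith [softmaxProb_le_one v y]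
  linarith

lemma neg_log_softmaxProb_nonneg (v : Fin k → ℝ) (y : Fin k) :
    0 ≤ -Real.log (softmaxProb v y) := by
  linarith [one_sub_softmaxProb_le_neg_log v y, softmaxProb_le_one v y]

/-- With ℓ = -log p this is ℓ - ℓ² ≤ 1 - exp(-ℓ). Agreement to first order is what preserves the
sharp rate γ in the decay of the loss. -/
lemma neg_log_sub_sq_le {y : Fin k} (h : -Real.log (softmaxProb v y) ≤ 1) :
    -Real.log (softmaxProb v y) - (-Real.log (softmaxProb v y)) ^ 2 ≤ 1 - softmaxProb v y := by
  have h0 := neg_log_softmaxProb_nonneg v y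
  have := Real.abs_exp_sub_one_sub_id_le (x := Real.log (softmaxProb v y))
    (abs_le.2 ⟨by linarith, by linarith⟩)
  rw [Real.exp_log (softmaxProb_pos v y)] at this
  have := (abs_le.1 this).2
  nlinarith

/-- The inverse probability exp(ℓ) is a sum containing 1 and the exponential of the negative margin,
and exp(ℓ) - 1 ≤ ℓ + ℓ² ≤ 2ℓ for ℓ ≤ 1. -/
lemma exp_neg_margin_le {y c : Fin k} (hc : c ≠ y) (h : -Real.log (softmaxProb v y) ≤ 1) :
    Real.exp (-(v y - v c)) ≤ 2 * -Real.log (softmaxProb v y) := by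
  have h0 := neg_log_softmaxProb_nonneg v y
  have h1 : 1 + Real.exp (-(v y - v c)) ≤ (softmaxProb v y)⁻¹ := by
    rw [inv_softmaxProb, ← Finset.add_sum_erase _ _ (Finset.mem_univ y), sub_self, Real.exp_zero,
      neg_sub]
    gcongr
    exact Finset.single_le_sum (f := fun c => Real.exp (v c - v y))
      (fun _ _ => (Real.exp_pos _).le) (by simp [hc])
  have h2 : (softmaxProb v y)⁻¹ = Real.exp (-Real.log (softmaxProb v y)) := by
    rw [Real.exp_neg, Real.exp_log (softmaxProb_pos v y)]
  have := Real.abs_exp_sub_one_sub_id_le (x := -Real.log (softmaxProb v y))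
    (abs_le.2 ⟨by linarith, h⟩)
  have := (abs_le.1 this).2
  nlinarith

/-- A bound that sees only the size of the logits, so that `t₂` can be fixed before the data. -/
lemma neg_log_softmaxProb_le_log_card_add (h : ∀ c, |v c| ≤ δ) (y : Fin k) :
    -Real.log (softmaxProb v y) ≤ Real.log k + 2 * δ := by
  have hk : (0 : ℝ) < k := by exact_mod_cast y.pos
  rw [← Real.log_inv, inv_softmaxProb, ← Real.log_exp (2 * δ),
    ← Real.log_mul hk.ne' (Real.exp_pos _).ne']
  refine Real.log_le_log (Finset.sum_pos (fun _ _ => Real.exp_pos _) ⟨y, Finset.mem_univ y⟩) ?_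
  have : ∀ c ∈ Finset.univ, Real.exp (v c - v y) ≤ Real.exp (2 * δ) := fun c _ =>
    Real.exp_le_exp.2 (by linarith [(abs_le.1 (h c)).2, (abs_le.1 (h y)).1])
  simpa using Finset.sum_le_card_nsmul _ _ _ this

end Softmax

/-! ### Gradients and their variation, relative to the mean error. -/

section MatrixLevel

variable {n k d : ℕ}

/-- The sum of the absolute values of the entries. -/
def entrySum (A : Matrix (Fin k) (Fin d) ℝ) : ℝ := ∑ i, ∑ j, |A i j|

/-- The mean probability of error of the softmax classifier on the data with index in `S`. -/
noncomputable def meanError (x : Fin n → Fin d → ℝ) (y : Fin n → Fin k) (S : Finset (Fin n))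
    (W : Matrix (Fin k) (Fin d) ℝ) : ℝ :=
  (1 / (S.card : ℝ)) * ∑ i ∈ S, (1 - softmaxProb (W.mulVec (x i)) (y i))

lemma entrySum_nonneg (A : Matrix (Fin k) (Fin d) ℝ) : 0 ≤ entrySum A :=
  Finset.sum_nonneg fun _ _ => Finset.sum_nonneg fun _ _ => abs_nonneg _

lemma entrySum_add_le (A B : Matrix (Fin k) (Fin d) ℝ) :
    entrySum (A + B) ≤ entrySum A + entrySum B := by
  unfold entrySum
  simp only [← Finset.sum_add_distrib]
  exact Finset.sum_le_sum fun i _ => Finset.sum_le_sum fun j _ => abs_add_le _ _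

lemma entrySum_smul (r : ℝ) (A : Matrix (Fin k) (Fin d) ℝ) :
    entrySum (r • A) = |r| * entrySum A := by
  simp only [entrySum, Matrix.smul_apply, smul_eq_mul, abs_mul, Finset.mul_sum]

lemma entrySum_sub_le (A B : Matrix (Fin k) (Fin d) ℝ) :
    entrySum (A - B) ≤ entrySum A + entrySum B := by
  have := entrySum_add_le A ((-1 : ℝ) • B)
  rwa [entrySum_smul, abs_neg, abs_one, one_mul, neg_one_smul, ← sub_eq_add_neg] at this

lemma entrySum_sum_le {ι : Type*} (S : Finset ι) (A : ι → Matrix (Fin k) (Fin d) ℝ) :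
    entrySum (∑ i ∈ S, A i) ≤ ∑ i ∈ S, entrySum (A i) :=
  Finset.le_sum_of_subadditive entrySum (by simp [entrySum]) entrySum_add_le S A

lemma matrixInner_eq_sum (A B : Matrix (Fin k) (Fin d) ℝ) :
    matrixInner A B = ∑ i, ∑ j, A i j * B i j := by
  simp only [matrixInner, Matrix.trace, Matrix.diag, Matrix.mul_apply, Matrix.transpose_apply]
  exact Finset.sum_comm

/-- Duality of ℓ_1 and ℓ_∞. Unit balls of an `IsEntryNorm` have entries at most 1, so `entrySum`
controls gradient errors for all the norms at once. -/
lemma abs_matrixInner_le (A B : Matrix (Fin k) (Fin d) ℝ) (hB : ∀ i j, |B i j| ≤ 1) :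
    |matrixInner A B| ≤ entrySum A := by
  rw [matrixInner_eq_sum]
  refine (Finset.abs_sum_le_sum_abs _ _).trans (Finset.sum_le_sum fun i _ => ?_)
  refine (Finset.abs_sum_le_sum_abs _ _).trans (Finset.sum_le_sum fun j _ => ?_)
  rw [abs_mul]
  exact mul_le_of_le_one_right (abs_nonneg _) (hB i j)

lemma matrixInner_sub_left (A B D : Matrix (Fin k) (Fin d) ℝ) :
    matrixInner (A - B) D = matrixInner A D - matrixInner B D := by
  simp [matrixInner, Matrix.sub_mul]

lemma abs_mulVec_le {A : Matrix (Fin k) (Fin d) ℝ} {δ R : ℝ} (hA : ∀ i j, |A i j| ≤ δ)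
    (hδ : 0 ≤ δ) {x : Fin d → ℝ} (hx : ∑ j, |x j| ≤ R) (c : Fin k) :
    |A.mulVec x c| ≤ R * δ := by
  simp only [Matrix.mulVec, dotProduct]
  refine (Finset.abs_sum_le_sum_abs _ _).trans ?_
  calc ∑ j, |A c j * x j| ≤ ∑ j, δ * |x j| := by
        refine Finset.sum_le_sum fun j _ => ?_
        rw [abs_mul]
        exact mul_le_mul_of_nonneg_right (hA c j) (abs_nonneg _)
    _ = δ * ∑ j, |x j| := by rw [Finset.mul_sum]
    _ ≤ R * δ := by rw [mul_comm]; exact mul_le_mul_of_nonneg_right hx hδ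

lemma empiricalLoss_eq_batchLoss (x : Fin n → Fin d → ℝ) (y : Fin n → Fin k) :
    empiricalLoss x y = batchLoss x y Finset.univ := by
  ext W
  simp [empiricalLoss, batchLoss]

lemma hasLineDerivAt_sampleLoss (x : Fin d → ℝ) (y : Fin k) (W : Matrix (Fin k) (Fin d) ℝ)
    (c : Fin k) (j : Fin d) :
    HasLineDerivAt ℝ (sampleLoss x y)
      ((softmaxProb (W.mulVec x) c - if c = y then 1 else 0) * x j) W
      (Matrix.single c j 1) := by
  have hmul : ∀ (t : ℝ) l, (W + t • Matrix.single c j (1 : ℝ)).mulVec x l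
      = W.mulVec x l + t * (if l = c then x j else 0) := by
    intro t l
    rw [Matrix.add_mulVec, Matrix.smul_mulVec, Matrix.single_mulVec]
    by_cases h : l = c
    · subst h; simp
    · simp [h]
  have hexp : ∀ l, HasDerivAt (fun t : ℝ => Real.exp (W.mulVec x l
      + t * (if l = c then x j else 0)))
      (Real.exp (W.mulVec x l) * (if l = c then x j else 0)) 0 := by
    intro l
    have h := (((hasDerivAt_id (0 : ℝ)).mul_const (if l = c then x j else 0)).const_add
      (W.mulVec x l)).exp
    simpa using h
  have hsum : HasDerivAt (fun t : ℝ => ∑ l, Real.exp (W.mulVec x l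
      + t * (if l = c then x j else 0))) (Real.exp (W.mulVec x c) * x j) 0 := by
    have h := HasDerivAt.fun_sum (u := Finset.univ) fun l _ => hexp l
    simpa using h
  have hlin : HasDerivAt (fun t : ℝ => W.mulVec x y + t * (if y = c then x j else 0))
      (if y = c then x j else 0) 0 := by
    simpa using ((hasDerivAt_id (0 : ℝ)).mul_const (if y = c then x j else 0)).const_add
      (W.mulVec x y)
  have hpos : ∀ v : Fin k → ℝ, 0 < ∑ l, Real.exp (v l) := fun v => sum_exp_pos v y
  have hfun : (fun t : ℝ => sampleLoss x y (W + t • Matrix.single c j 1))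
      = fun t : ℝ => Real.log (∑ l, Real.exp (W.mulVec x l
          + t * (if l = c then x j else 0)))
        - (W.mulVec x y + t * (if y = c then x j else 0)) := by
    ext t
    simp only [sampleLoss, softmaxProb, hmul]
    rw [Real.log_div (Real.exp_pos _).ne' (hpos _).ne', Real.log_exp]
    ring
  unfold HasLineDerivAt
  rw [hfun]
  convert! (hsum.log (by simpa using (hpos _).ne')).sub hlin using 1
  simp only [softmaxProb, zero_mul, add_zero, eq_comm (a := y)]
  split_ifs <;> ring

lemma matrixGradient_batchLoss_apply (x : Fin n → Fin d → ℝ) (y : Fin n → Fin k)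
    (S : Finset (Fin n)) (W : Matrix (Fin k) (Fin d) ℝ) (c : Fin k) (j : Fin d) :
    matrixGradient (batchLoss x y S) W c j = (1 / (S.card : ℝ)) *
      ∑ i ∈ S, (softmaxProb (W.mulVec (x i)) c - if c = y i then 1 else 0) * x i j := by
  simp only [matrixGradient, Matrix.of_apply]
  refine HasLineDerivAt.lineDeriv ?_
  unfold HasLineDerivAt batchLoss
  exact (HasDerivAt.fun_sum fun i _ =>
    hasLineDerivAt_sampleLoss (x i) (y i) W c j).const_mul _

lemma matrixGradient_batchLoss (x : Fin n → Fin d → ℝ) (y : Fin n → Fin k)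
    (S : Finset (Fin n)) (W : Matrix (Fin k) (Fin d) ℝ) :
    matrixGradient (batchLoss x y S) W = (1 / (S.card : ℝ)) • ∑ i ∈ S, Matrix.vecMulVec
      (fun c => softmaxProb (W.mulVec (x i)) c - if c = y i then 1 else 0) (x i) := by
  ext c j
  rw [matrixGradient_batchLoss_apply, Matrix.smul_apply, Matrix.sum_apply]
  simp [Matrix.vecMulVec_apply]

lemma entrySum_vecMulVec (v : Fin k → ℝ) (x : Fin d → ℝ) :
    entrySum (Matrix.vecMulVec v x) = (∑ c, |v c|) * ∑ j, |x j| := by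
  simp only [entrySum, Matrix.vecMulVec_apply, abs_mul, Finset.sum_mul_sum]

lemma matrixInner_matrixGradient (x : Fin n → Fin d → ℝ) (y : Fin n → Fin k)
    (S : Finset (Fin n)) (W D : Matrix (Fin k) (Fin d) ℝ) :
    matrixInner (matrixGradient (batchLoss x y S) W) D = (1 / (S.card : ℝ)) *
      ∑ i ∈ S, ∑ c, (softmaxProb (W.mulVec (x i)) c - if c = y i then 1 else 0)
        * D.mulVec (x i) c := by
  have h : ∀ (f : Fin k → ℝ) (a : Fin d → ℝ),
      matrixInner (Matrix.vecMulVec f a) D = ∑ c, f c * D.mulVec a c := by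
    intro f a
    simp only [matrixInner_eq_sum, Matrix.vecMulVec_apply, Matrix.mulVec, dotProduct,
      Finset.mul_sum]
    exact Finset.sum_congr rfl fun c _ => Finset.sum_congr rfl fun j _ => by ring
  simp only [← h]
  rw [matrixGradient_batchLoss]
  simp only [matrixInner, Matrix.transpose_smul, Matrix.transpose_sum, Matrix.smul_mul,
    Matrix.sum_mul, Matrix.trace_smul, Matrix.trace_sum, smul_eq_mul]

variable {x : Fin n → Fin d → ℝ} {y : Fin n → Fin k} {S : Finset (Fin n)} {R δ : ℝ}
  {W W' : Matrix (Fin k) (Fin d) ℝ}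

lemma meanError_nonneg (x : Fin n → Fin d → ℝ) (y : Fin n → Fin k) (S : Finset (Fin n))
    (W : Matrix (Fin k) (Fin d) ℝ) : 0 ≤ meanError x y S W :=
  mul_nonneg (by positivity)
    (Finset.sum_nonneg fun _ _ => sub_nonneg.2 (softmaxProb_le_one _ _))

lemma abs_mulVec_sub_le (hx : ∀ i, ∑ j, |x i j| ≤ R) (hδ : 0 ≤ δ)
    (hW : ∀ i j, |W' i j - W i j| ≤ δ) (i : Fin n) (c : Fin k) :
    |W'.mulVec (x i) c - W.mulVec (x i) c| ≤ R * δ := by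
  have := abs_mulVec_le (A := W' - W) hW hδ (hx i) c
  rwa [Matrix.sub_mulVec] at this

lemma meanError_le_exp_mul (hx : ∀ i, ∑ j, |x i j| ≤ R) (hδ : 0 ≤ δ)
    (hW : ∀ i j, |W' i j - W i j| ≤ δ) :
    meanError x y S W' ≤ Real.exp (2 * R * δ) * meanError x y S W := by
  unfold meanError
  rw [mul_left_comm]
  refine mul_le_mul_of_nonneg_left ?_ (by positivity)
  rw [Finset.mul_sum, mul_assoc]
  exact Finset.sum_le_sum fun i _ =>
    one_sub_softmaxProb_le_exp_mul (abs_mulVec_sub_le hx hδ hW i) _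

lemma entrySum_mean_le {f : Fin n → Fin k → ℝ} {r : ℝ} (hR : 0 ≤ R)
    (hx : ∀ i, ∑ j, |x i j| ≤ R)
    (hf : ∀ i, ∑ c, |f i c| ≤ r * (1 - softmaxProb (W.mulVec (x i)) (y i))) :
    entrySum ((1 / (S.card : ℝ)) • ∑ i ∈ S, Matrix.vecMulVec (f i) (x i))
      ≤ R * r * meanError x y S W := by
  rw [entrySum_smul, abs_of_nonneg (by positivity), meanError, mul_left_comm]
  refine mul_le_mul_of_nonneg_left ?_ (by positivity)
  refine (entrySum_sum_le _ _).trans ?_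
  rw [Finset.mul_sum]
  refine Finset.sum_le_sum fun i _ => ?_
  rw [entrySum_vecMulVec, mul_comm, mul_assoc]
  exact mul_le_mul (hx i) (hf i) (Finset.sum_nonneg fun _ _ => abs_nonneg _) hR

lemma entrySum_gradient_le (hR : 0 ≤ R) (hx : ∀ i, ∑ j, |x i j| ≤ R)
    (S : Finset (Fin n)) (W : Matrix (Fin k) (Fin d) ℝ) :
    entrySum (matrixGradient (batchLoss x y S) W) ≤ 2 * R * meanError x y S W := by
  rw [matrixGradient_batchLoss, mul_comm 2 R]
  exact entrySum_mean_le hR hx fun i => (sum_abs_softmaxProb_sub_indicator _ _).le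

lemma entrySum_gradient_sub_le (hR : 0 ≤ R) (hx : ∀ i, ∑ j, |x i j| ≤ R) (hδ : 0 ≤ δ)
    (hW : ∀ i j, |W' i j - W i j| ≤ δ) :
    entrySum (matrixGradient (batchLoss x y S) W' - matrixGradient (batchLoss x y S) W)
      ≤ 2 * R * (Real.exp (2 * R * δ) - 1) * meanError x y S W := by
  have h : matrixGradient (batchLoss x y S) W' - matrixGradient (batchLoss x y S) W
      = (1 / (S.card : ℝ)) • ∑ i ∈ S, Matrix.vecMulVec
        (fun c => softmaxProb (W'.mulVec (x i)) c - softmaxProb (W.mulVec (x i)) c) (x i) := by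
    rw [matrixGradient_batchLoss, matrixGradient_batchLoss, ← smul_sub,
      ← Finset.sum_sub_distrib]
    congr 1
    refine Finset.sum_congr rfl fun i _ => ?_
    ext c j
    simp only [Matrix.sub_apply, Matrix.vecMulVec_apply]
    ring
  rw [h, show 2 * R * (Real.exp (2 * R * δ) - 1) = R * (2 * (Real.exp (2 * R * δ) - 1)) by ring]
  refine entrySum_mean_le hR hx fun i => ?_
  have := sum_abs_softmaxProb_sub_le (abs_mulVec_sub_le hx hδ hW i) (y i)
  rwa [← mul_assoc] at this

lemma batchLoss_sub_smul_le (hx : ∀ i, ∑ j, |x i j| ≤ R) {η : ℝ} (hη : 0 ≤ η)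
    {D : Matrix (Fin k) (Fin d) ℝ} (hD : ∀ i j, |D i j| ≤ 1) (S : Finset (Fin n))
    (W : Matrix (Fin k) (Fin d) ℝ) :
    batchLoss x y S (W - η • D) ≤ batchLoss x y S W
      - η * matrixInner (matrixGradient (batchLoss x y S) W) D
      + 4 * (R * η) ^ 2 * Real.exp (2 * (R * η)) * meanError x y S W := by
  have hW : ∀ i j, |(W - η • D) i j - W i j| ≤ η := by
    intro i j
    simp only [Matrix.sub_apply, Matrix.smul_apply, smul_eq_mul, sub_sub_cancel_left, abs_neg,
      abs_mul, abs_of_nonneg hη]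
    exact mul_le_of_le_one_right hη (hD i j)
  rw [matrixInner_matrixGradient]
  unfold batchLoss meanError
  have h : ∀ i ∈ S, sampleLoss (x i) (y i) (W - η • D) ≤ sampleLoss (x i) (y i) W
      - η * (∑ c, (softmaxProb (W.mulVec (x i)) c - if c = y i then 1 else 0)
        * D.mulVec (x i) c)
      + 4 * (R * η) ^ 2 * Real.exp (2 * (R * η))
        * (1 - softmaxProb (W.mulVec (x i)) (y i)) := by
    intro i _
    refine (neg_log_softmaxProb_le (abs_mulVec_sub_le hx hη hW i) (y i)).trans (le_of_eq ?_)
    rw [sampleLoss, sub_eq_add_neg (-Real.log _)]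
    congr 2
    rw [Finset.mul_sum, ← Finset.sum_neg_distrib]
    refine Finset.sum_congr rfl fun c _ => ?_
    rw [Matrix.sub_mulVec, Matrix.smul_mulVec]
    simp only [Pi.sub_apply, Pi.smul_apply, smul_eq_mul]
    ring
  have h2 := mul_le_mul_of_nonneg_left (Finset.sum_le_sum h)
    (show (0 : ℝ) ≤ 1 / (S.card : ℝ) by positivity)
  refine h2.trans (le_of_eq ?_)
  rw [Finset.sum_add_distrib, Finset.sum_sub_distrib, ← Finset.mul_sum, ← Finset.mul_sum]
  ring

/-- The gradient correlates with every matrix of positive margin. -/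
lemma matrixInner_gradient_neg_ge {U : Matrix (Fin k) (Fin d) ℝ} {μ : ℝ}
    (hU : ∀ i c, c ≠ y i → μ ≤ U.mulVec (x i) (y i) - U.mulVec (x i) c)
    (S : Finset (Fin n)) (W : Matrix (Fin k) (Fin d) ℝ) :
    μ * meanError x y S W ≤ matrixInner (matrixGradient (batchLoss x y S) W) (-U) := by
  rw [matrixInner_matrixGradient, meanError, mul_left_comm]
  refine mul_le_mul_of_nonneg_left ?_ (by positivity)
  rw [Finset.mul_sum]
  refine Finset.sum_le_sum fun i _ => ?_
  rw [sum_softmaxProb_sub_indicator_mul, one_sub_softmaxProb, Finset.mul_sum,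
    ← Finset.add_sum_erase _ _ (Finset.mem_univ (y i)), sub_self, mul_zero, zero_add]
  refine Finset.sum_le_sum fun c hc => ?_
  rw [mul_comm, Matrix.neg_mulVec]
  refine mul_le_mul_of_nonneg_left ?_ (softmaxProb_pos _ _).le
  have := hU i c (Finset.ne_of_mem_erase hc)
  simp only [Pi.neg_apply]
  linarith

/-- The summands are nonnegative and 1/b = m/n; this is the price m of replacing a batch by the full
data. -/
lemma meanError_le_mul {m b : ℕ} (hb : 1 ≤ b) (hn : n = m * b) (hS : S.card = b) :
    meanError x y S W ≤ m * meanError x y Finset.univ W := by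
  have hb' : (b : ℝ) ≠ 0 := by exact_mod_cast (by lia : b ≠ 0)
  rcases Nat.eq_zero_or_pos m with rfl | hm
  · have hS0 : S.card ≤ 0 := by
      have := S.card_le_univ
      rw [Fintype.card_fin] at this
      lia
    lia
  have hm' : (m : ℝ) ≠ 0 := by exact_mod_cast hm.ne'
  simp only [meanError, hS, Finset.card_univ, Fintype.card_fin]
  have h : (m : ℝ) * (1 / (n : ℝ)) = 1 / (b : ℝ) := by
    rw [hn]; push_cast; field_simp
  rw [← mul_assoc, h]
  refine mul_le_mul_of_nonneg_left ?_ (by positivity)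
  exact Finset.sum_le_univ_sum_of_nonneg fun i => sub_nonneg.2 (softmaxProb_le_one _ _)

end MatrixLevel

/-! ### Loss, mean error and margin. -/

section LossFacts

variable {n k d : ℕ} {x : Fin n → Fin d → ℝ} {y : Fin n → Fin k}
  {W : Matrix (Fin k) (Fin d) ℝ} {R : ℝ}

lemma sampleLoss_nonneg (x : Fin d → ℝ) (y : Fin k) (W : Matrix (Fin k) (Fin d) ℝ) :
    0 ≤ sampleLoss x y W := neg_log_softmaxProb_nonneg _ _

lemma mul_empiricalLoss (hn : 0 < n) (x : Fin n → Fin d → ℝ) (y : Fin n → Fin k)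
    (W : Matrix (Fin k) (Fin d) ℝ) :
    n * empiricalLoss x y W = ∑ i, sampleLoss (x i) (y i) W := by
  have : (n : ℝ) ≠ 0 := by exact_mod_cast hn.ne'
  rw [empiricalLoss]
  field_simp

lemma mul_meanError_univ (hn : 0 < n) (x : Fin n → Fin d → ℝ) (y : Fin n → Fin k)
    (W : Matrix (Fin k) (Fin d) ℝ) :
    n * meanError x y Finset.univ W = ∑ i, (1 - softmaxProb (W.mulVec (x i)) (y i)) := by
  have : (n : ℝ) ≠ 0 := by exact_mod_cast hn.ne'
  rw [meanError, Finset.card_univ, Fintype.card_fin]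
  field_simp

lemma sampleLoss_le (hn : 0 < n) (x : Fin n → Fin d → ℝ) (y : Fin n → Fin k)
    (W : Matrix (Fin k) (Fin d) ℝ) (i : Fin n) :
    sampleLoss (x i) (y i) W ≤ n * empiricalLoss x y W := by
  rw [mul_empiricalLoss hn]
  exact Finset.single_le_sum (f := fun i => sampleLoss (x i) (y i) W)
    (fun i _ => sampleLoss_nonneg _ _ _) (Finset.mem_univ i)

lemma one_sub_softmaxProb_le_mul_meanError (hn : 0 < n) (x : Fin n → Fin d → ℝ)
    (y : Fin n → Fin k) (W : Matrix (Fin k) (Fin d) ℝ) (i : Fin n) :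
    1 - softmaxProb (W.mulVec (x i)) (y i) ≤ n * meanError x y Finset.univ W := by
  rw [mul_meanError_univ hn]
  exact Finset.single_le_sum (f := fun i => 1 - softmaxProb (W.mulVec (x i)) (y i))
    (fun i _ => sub_nonneg.2 (softmaxProb_le_one _ _)) (Finset.mem_univ i)

lemma meanError_pos (hn : 0 < n) (hk : 2 ≤ k) (x : Fin n → Fin d → ℝ) (y : Fin n → Fin k)
    (W : Matrix (Fin k) (Fin d) ℝ) : 0 < meanError x y Finset.univ W := by
  have : Nontrivial (Fin k) := Fin.nontrivial_iff_two_le.2 hk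
  obtain ⟨c, hc⟩ := exists_ne (y ⟨0, hn⟩)
  have h := one_sub_softmaxProb_le_mul_meanError hn x y W ⟨0, hn⟩
  have h' := softmaxProb_lt_one (W.mulVec (x ⟨0, hn⟩)) hc
  have hn' : (0 : ℝ) < n := by exact_mod_cast hn
  exact pos_of_mul_pos_right (by linarith) hn'.le

lemma meanError_le_empiricalLoss (x : Fin n → Fin d → ℝ) (y : Fin n → Fin k)
    (W : Matrix (Fin k) (Fin d) ℝ) : meanError x y Finset.univ W ≤ empiricalLoss x y W := by
  rw [meanError, empiricalLoss, Finset.card_univ, Fintype.card_fin]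
  exact mul_le_mul_of_nonneg_left
    (Finset.sum_le_sum fun i _ => one_sub_softmaxProb_le_neg_log _ _) (by positivity)

lemma empiricalLoss_le_two_mul_meanError
    (h : ∀ i, 1 / 2 ≤ softmaxProb (W.mulVec (x i)) (y i)) :
    empiricalLoss x y W ≤ 2 * meanError x y Finset.univ W := by
  rw [meanError, empiricalLoss, Finset.card_univ, Fintype.card_fin, mul_left_comm]
  refine mul_le_mul_of_nonneg_left ?_ (by positivity)
  rw [Finset.mul_sum]
  exact Finset.sum_le_sum fun i _ => neg_log_softmaxProb_le_two_mul (h i)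

lemma half_le_softmaxProb_of_loss (hn : 0 < n) (h : n * empiricalLoss x y W ≤ 1 / 2)
    (i : Fin n) : 1 / 2 ≤ softmaxProb (W.mulVec (x i)) (y i) := by
  have h1 := (sampleLoss_le hn x y W i).trans h
  have h2 := one_sub_softmaxProb_le_neg_log (W.mulVec (x i)) (y i)
  unfold sampleLoss at h1
  linarith

lemma half_le_softmaxProb_of_meanError (hn : 0 < n)
    (h : n * meanError x y Finset.univ W ≤ 1 / 4) (i : Fin n) :
    1 / 2 ≤ softmaxProb (W.mulVec (x i)) (y i) := by
  linarith [one_sub_softmaxProb_le_mul_meanError hn x y W i]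

/-- Each ℓ_i ≤ n L, so summing ℓ_i (1 - ℓ_i) ≤ 1 - p_i gives at least (1 - n L) Σ ℓ_i on the left.
-/
lemma mul_one_sub_le_meanError (hn : 0 < n) (h : n * empiricalLoss x y W ≤ 1) :
    empiricalLoss x y W * (1 - n * empiricalLoss x y W) ≤ meanError x y Finset.univ W := by
  have hn' : (0 : ℝ) < n := by exact_mod_cast hn
  have key : n * (empiricalLoss x y W * (1 - n * empiricalLoss x y W))
      ≤ n * meanError x y Finset.univ W := by
    rw [mul_meanError_univ hn, ← mul_assoc, mul_empiricalLoss hn, Finset.sum_mul]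
    refine Finset.sum_le_sum fun i _ => ?_
    have h1 := sampleLoss_le hn x y W i
    rw [mul_empiricalLoss hn] at h1 h
    have h2 := neg_log_sub_sq_le (h1.trans h)
    have h3 := sampleLoss_nonneg (x i) (y i) W
    change sampleLoss (x i) (y i) W - sampleLoss (x i) (y i) W ^ 2 ≤ _ at h2
    nlinarith
  exact le_of_mul_le_mul_left key hn'

lemma empiricalLoss_le_log_card_add (hn : 0 < n) {δ : ℝ} (hδ : 0 ≤ δ)
    (hx : ∀ i, ∑ j, |x i j| ≤ R) (hW : ∀ i j, |W i j| ≤ δ) :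
    empiricalLoss x y W ≤ Real.log k + 2 * (R * δ) := by
  have hn' : (0 : ℝ) < n := by exact_mod_cast hn
  refine le_of_mul_le_mul_left ?_ hn'
  rw [mul_empiricalLoss hn]
  have : ∀ i ∈ Finset.univ, sampleLoss (x i) (y i) W ≤ Real.log k + 2 * (R * δ) := fun i _ =>
    neg_log_softmaxProb_le_log_card_add (fun c => abs_mulVec_le hW hδ (hx i) c) _
  simpa [mul_add] using Finset.sum_le_card_nsmul _ _ _ this

lemma minMargin_le (x : Fin n → Fin d → ℝ) (y : Fin n → Fin k)
    (W : Matrix (Fin k) (Fin d) ℝ) (i : Fin n) {c : Fin k} (hc : c ≠ y i) :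
    minMargin x y W ≤ W.mulVec (x i) (y i) - W.mulVec (x i) c :=
  ciInf_le (f := fun q : {q : Fin n × Fin k // q.2 ≠ y q.1} =>
    W.mulVec (x q.1.1) (y q.1.1) - W.mulVec (x q.1.1) q.1.2) (Set.finite_range _).bddBelow
    ⟨(i, c), hc⟩

lemma nonempty_margin_index (hn : 0 < n) (hk : 2 ≤ k) (y : Fin n → Fin k) :
    Nonempty {q : Fin n × Fin k // q.2 ≠ y q.1} := by
  have : Nontrivial (Fin k) := Fin.nontrivial_iff_two_le.2 hk
  obtain ⟨c, hc⟩ := exists_ne (y ⟨0, hn⟩)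
  exact ⟨⟨(⟨0, hn⟩, c), hc⟩⟩

lemma neg_log_le_minMargin (hn : 0 < n) (hk : 2 ≤ k) (h : n * empiricalLoss x y W ≤ 1) :
    -Real.log (2 * (n * empiricalLoss x y W)) ≤ minMargin x y W := by
  have := nonempty_margin_index hn hk y
  refine le_ciInf fun ⟨⟨i, c⟩, hc⟩ => ?_
  have h1 := sampleLoss_le hn x y W i
  have h2 := exp_neg_margin_le hc (h1.trans h)
  have h3 : Real.exp (-(W.mulVec (x i) (y i) - W.mulVec (x i) c))
      ≤ 2 * (n * empiricalLoss x y W) := h2.trans (by unfold sampleLoss at h1; linarith)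
  have h4 := Real.log_le_log (Real.exp_pos _) h3
  rw [Real.log_exp] at h4
  simp only
  linarith

variable {N : Matrix (Fin k) (Fin d) ℝ → ℝ}

lemma IsEntryNorm.nonneg (hN : IsEntryNorm N) (W : Matrix (Fin k) (Fin d) ℝ) : 0 ≤ N W := by
  have h0 : N 0 = 0 := by simpa using hN.smul 0 0
  have h1 := hN.add_le W ((-1 : ℝ) • W)
  rw [hN.smul, neg_one_smul, add_neg_cancel, h0] at h1
  simp at h1
  linarith

lemma IsEntryNorm.neg (hN : IsEntryNorm N) (W : Matrix (Fin k) (Fin d) ℝ) : N (-W) = N W := by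
  have := hN.smul (-1) W
  simpa using this

lemma minMargin_le_two_mul (hN : IsEntryNorm N) (hn : 0 < n) (hk : 2 ≤ k)
    (hx : ∀ i, ∑ j, |x i j| ≤ R) (W : Matrix (Fin k) (Fin d) ℝ) :
    minMargin x y W ≤ 2 * R * N W := by
  obtain ⟨⟨i, c⟩, hc⟩ := nonempty_margin_index hn hk y
  refine (minMargin_le x y W i hc).trans ?_
  have h1 := abs_mulVec_le (hN.abs_entry_le W) (hN.nonneg W) (hx i) (y i)
  have h2 := abs_mulVec_le (hN.abs_entry_le W) (hN.nonneg W) (hx i) c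
  linarith [(abs_le.1 h1).2, (abs_le.1 h2).1]

lemma minMargin_smul {r : ℝ} (hr : 0 ≤ r) (x : Fin n → Fin d → ℝ) (y : Fin n → Fin k)
    (W : Matrix (Fin k) (Fin d) ℝ) : minMargin x y (r • W) = r * minMargin x y W := by
  unfold minMargin
  rw [Real.mul_iInf_of_nonneg hr]
  congr 1
  ext q
  simp [Matrix.smul_mulVec, mul_sub]

lemma bddAbove_minMargin (hN : IsEntryNorm N) (hn : 0 < n) (hk : 2 ≤ k) (hR : 0 ≤ R)
    (hx : ∀ i, ∑ j, |x i j| ≤ R) : BddAbove (minMargin x y '' {W | N W ≤ 1}) := by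
  refine ⟨2 * R, ?_⟩
  rintro _ ⟨W, hW, rfl⟩
  exact (minMargin_le_two_mul hN hn hk hx W).trans
    (mul_le_of_le_one_right (by linarith) hW)

lemma minMargin_div_le_maxMargin (hN : IsEntryNorm N) (hn : 0 < n) (hk : 2 ≤ k) (hR : 0 ≤ R)
    (hx : ∀ i, ∑ j, |x i j| ≤ R) (hW : 0 < N W) :
    minMargin x y W / N W ≤ maxMargin N x y := by
  have h : N ((N W)⁻¹ • W) ≤ 1 := by
    rw [hN.smul, abs_of_pos (inv_pos.2 hW), inv_mul_cancel₀ hW.ne']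
  have := le_csSup (bddAbove_minMargin (y := y) hN hn hk hR hx) ⟨_, h, rfl⟩
  rw [minMargin_smul (inv_pos.2 hW).le] at this
  rwa [div_eq_inv_mul]

lemma maxMargin_pos (hN : IsEntryNorm N) (hn : 0 < n) (hk : 2 ≤ k) (hR : 0 < R)
    (hx : ∀ i, ∑ j, |x i j| ≤ R) (hsep : LinearlySeparable x y) : 0 < maxMargin N x y := by
  obtain ⟨W, hW⟩ := hsep
  have hne := nonempty_margin_index hn hk y
  have hpos : 0 < minMargin x y W := by
    obtain ⟨⟨⟨i, c⟩, hc⟩, hq⟩ := exists_eq_ciInf_of_finite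
      (f := fun q : {q : Fin n × Fin k // q.2 ≠ y q.1} =>
        W.mulVec (x q.1.1) (y q.1.1) - W.mulVec (x q.1.1) q.1.2)
    rw [minMargin, ← hq]
    exact hW i c hc
  have hNW : 0 < N W := by
    have := minMargin_le_two_mul (y := y) hN hn hk hx W
    exact pos_of_mul_pos_right (hpos.trans_le this) (by linarith)
  exact (div_pos hpos hNW).trans_le (minMargin_div_le_maxMargin hN hn hk hR.le hx hNW)

lemma exists_lt_minMargin (hN : IsEntryNorm N) {μ : ℝ} (hμ : μ < maxMargin N x y) :
    ∃ U, N U ≤ 1 ∧ μ < minMargin x y U := by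
  have h0 : N 0 = 0 := by simpa using hN.smul 0 0
  obtain ⟨_, ⟨U, hU, rfl⟩, h⟩ := exists_lt_of_lt_csSup
    (Set.Nonempty.image _ ⟨0, by simp [h0]⟩) hμ
  exact ⟨U, hU, h⟩

/-- The steepest descent direction of an approximate gradient is a descent direction. -/
lemma matrixInner_steepest_ge (hN : IsEntryNorm N) (hn : 0 < n) (hk : 2 ≤ k)
    {H D : Matrix (Fin k) (Fin d) ℝ} {ε : ℝ} (hD : IsSteepestDirection N H D)
    (hH : entrySum (H - matrixGradient (empiricalLoss x y) W)
      ≤ ε * meanError x y Finset.univ W) :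
    (maxMargin N x y - 2 * ε) * meanError x y Finset.univ W
      ≤ matrixInner (matrixGradient (empiricalLoss x y) W) D := by
  have hG := meanError_pos hn hk x y W
  -- Comparing D with -U, for U of margin above μ, costs the signal error twice, once for each
  -- direction: hence 2ε. Near-maximizers suffice, so no attainment of the supremum is needed.
  have key : ∀ μ < maxMargin N x y, μ ≤
      (matrixInner (matrixGradient (empiricalLoss x y) W) D) / meanError x y Finset.univ W
        + 2 * ε := by
    intro μ hμ
    obtain ⟨U, hU, hUμ⟩ := exists_lt_minMargin hN hμ
    have h1 := hD.2 (-U) (by rwa [hN.neg])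
    have h2 := matrixInner_gradient_neg_ge (x := x) (y := y) (U := U) (μ := μ)
      (fun i c hc => hUμ.le.trans (minMargin_le x y U i hc)) Finset.univ W
    rw [← empiricalLoss_eq_batchLoss] at h2
    have h3 := abs_le.1 (abs_matrixInner_le
      (H - matrixGradient (empiricalLoss x y) W) D
      fun i j => (hN.abs_entry_le D i j).trans hD.1)
    have h4 := abs_le.1 (abs_matrixInner_le
      (H - matrixGradient (empiricalLoss x y) W) (-U)
      fun i j => (hN.abs_entry_le (-U) i j).trans (by rwa [hN.neg]))
    rw [matrixInner_sub_left] at h3 h4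
    rw [← sub_le_iff_le_add, le_div_iff₀ hG]
    linarith [h3.2, h4.1]
  have := le_of_forall_lt_imp_le_of_dense key
  rw [← sub_le_iff_le_add, le_div_iff₀ hG] at this
  exact this

end LossFacts

/-! ### Relative error of the descent signal. -/

section SignalError

variable {n k d : ℕ}

/-- The length of the path from the beginning of the epoch of iteration `t` to `t`. -/
noncomputable def epochPath (m : ℕ) (η : ℕ → ℝ) (t : ℕ) : ℝ :=
  ∑ s ∈ Finset.Ico (m * (t / m)) t, η s

/-- Relative error of the variance-reduced gradient. -/
noncomputable def vrError (R : ℝ) (m : ℕ) (η : ℕ → ℝ) (t : ℕ) : ℝ :=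
  2 * R * (m + 1) * (Real.exp (2 * R * epochPath m η t) - 1)

/-- Relative error of the momentum buffer. -/
noncomputable def momentumError (R β : ℝ) (m : ℕ) (η : ℕ → ℝ) : ℕ → ℝ
  | 0 => β * (2 * R)
  | t + 1 => β * (Real.exp (2 * R * η t) * momentumError R β m η t
      + 2 * R * (Real.exp (2 * R * η t) - 1)) + (1 - β) * vrError R m η (t + 1)

/-- Relative error of the descent signal. -/
noncomputable def signalError (momentum : Bool) (R β : ℝ) (m : ℕ) (η : ℕ → ℝ) (t : ℕ) : ℝ :=
  if momentum then momentumError R β m η t else vrError R m η t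

variable {R β : ℝ} {m : ℕ} {η : ℕ → ℝ}

lemma epochPath_nonneg (hη : ∀ t, 0 ≤ η t) (t : ℕ) : 0 ≤ epochPath m η t :=
  Finset.sum_nonneg fun s _ => hη s

lemma vrError_nonneg (hR : 0 ≤ R) (hη : ∀ t, 0 ≤ η t) (t : ℕ) : 0 ≤ vrError R m η t := by
  have : 1 ≤ Real.exp (2 * R * epochPath m η t) :=
    Real.one_le_exp (mul_nonneg (by linarith) (epochPath_nonneg hη t))
  exact mul_nonneg (by positivity) (by linarith)

lemma momentumError_nonneg (hR : 0 ≤ R) (hβ : 0 ≤ β) (hβ' : β < 1) (hη : ∀ t, 0 ≤ η t)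
    (t : ℕ) : 0 ≤ momentumError R β m η t := by
  induction t with
  | zero => exact mul_nonneg hβ (by linarith)
  | succ t ih =>
    have : 1 ≤ Real.exp (2 * R * η t) := Real.one_le_exp (mul_nonneg (by linarith) (hη t))
    have h1 := vrError_nonneg (m := m) hR hη (t + 1)
    exact add_nonneg (mul_nonneg hβ (add_nonneg (by positivity)
      (mul_nonneg (by linarith) (by linarith)))) (mul_nonneg (by linarith) h1)

variable {x : Fin n → Fin d → ℝ} {y : Fin n → Fin k} {B : ℕ → Finset (Fin n)}
  {W : ℕ → Matrix (Fin k) (Fin d) ℝ} {b : ℕ}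

lemma abs_entry_sub_le_sum (hW : ∀ t i j, |W (t + 1) i j - W t i j| ≤ η t) {s t : ℕ}
    (hst : s ≤ t) (i : Fin k) (j : Fin d) :
    |W t i j - W s i j| ≤ ∑ r ∈ Finset.Ico s t, η r := by
  induction t, hst using Nat.le_induction with
  | base => simp
  | succ t hst ih =>
    rw [Finset.sum_Ico_succ_top hst]
    have := abs_sub_le (W (t + 1) i j) (W t i j) (W s i j)
    linarith [hW t i j]

/-- The error is a full-gradient difference minus a batch-gradient difference, both between snapshot
and current iterate. Relative to G they cost 1 and m, hence the factor m + 1. -/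
lemma entrySum_vrEstimator_sub_le (hR : 0 ≤ R) (hx : ∀ i, ∑ j, |x i j| ≤ R) (hb : 1 ≤ b)
    (hn : n = m * b) (hB : ∀ t, (B t).card = b) (hη : ∀ t, 0 ≤ η t)
    (hW : ∀ t i j, |W (t + 1) i j - W t i j| ≤ η t) (t : ℕ) :
    entrySum (vrEstimator x y m B W t - matrixGradient (empiricalLoss x y) (W t))
      ≤ vrError R m η t * meanError x y Finset.univ (W t) := by
  have hδ := epochPath_nonneg (m := m) hη t
  have hent : ∀ i j, |W (m * (t / m)) i j - W t i j| ≤ epochPath m η t := fun i j => by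
    rw [abs_sub_comm]
    exact abs_entry_sub_le_sum hW (Nat.mul_div_le t m) i j
  have h1 := entrySum_gradient_sub_le (y := y) (S := B t) hR hx hδ hent
  have h2 := entrySum_gradient_sub_le (y := y) (S := Finset.univ) hR hx hδ hent
  have hG := meanError_le_mul (x := x) (y := y) (W := W t) hb hn (hB t)
  have heq : vrEstimator x y m B W t - matrixGradient (empiricalLoss x y) (W t)
      = (matrixGradient (empiricalLoss x y) (W (m * (t / m)))
          - matrixGradient (empiricalLoss x y) (W t))
        - (matrixGradient (batchLoss x y (B t)) (W (m * (t / m)))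
          - matrixGradient (batchLoss x y (B t)) (W t)) := by
    unfold vrEstimator
    abel
  rw [heq]
  refine (entrySum_sub_le _ _).trans ?_
  rw [empiricalLoss_eq_batchLoss]
  have he : 0 ≤ 2 * R * (Real.exp (2 * R * epochPath m η t) - 1) :=
    mul_nonneg (by linarith)
      (sub_nonneg.2 (Real.one_le_exp (mul_nonneg (by linarith) hδ)))
  have h3 := mul_le_mul_of_nonneg_left hG he
  unfold vrError
  linarith

lemma entrySum_momentumBuffer_sub_le (hR : 0 ≤ R) (hx : ∀ i, ∑ j, |x i j| ≤ R) (hb : 1 ≤ b)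
    (hn : n = m * b) (hB : ∀ t, (B t).card = b) (hβ : 0 ≤ β) (hβ' : β < 1)
    (hη : ∀ t, 0 ≤ η t) (hW : ∀ t i j, |W (t + 1) i j - W t i j| ≤ η t) (t : ℕ) :
    entrySum (momentumBuffer β (vrEstimator x y m B W) t
        - matrixGradient (empiricalLoss x y) (W t))
      ≤ momentumError R β m η t * meanError x y Finset.univ (W t) := by
  induction t with
  | zero =>
    -- At time 0 the snapshot is the iterate itself, so V_0 is the full gradient. Only the bias from
    -- the zero initialization remains.
    have h : momentumBuffer β (vrEstimator x y m B W) 0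
        - matrixGradient (empiricalLoss x y) (W 0)
        = (-β) • matrixGradient (batchLoss x y Finset.univ) (W 0) := by
      simp only [momentumBuffer, vrEstimator, Nat.zero_div, mul_zero, sub_self, zero_add,
        empiricalLoss_eq_batchLoss]
      module
    rw [h, entrySum_smul, abs_neg, abs_of_nonneg hβ, momentumError, mul_assoc]
    exact mul_le_mul_of_nonneg_left (entrySum_gradient_le hR hx _ _) hβ
  | succ t ih =>
    have hent : ∀ i j, |W t i j - W (t + 1) i j| ≤ η t := fun i j => by
      rw [abs_sub_comm]; exact hW t i j
    have h1 := entrySum_gradient_sub_le (y := y) (S := Finset.univ) hR hx (hη t) hent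
    have h2 := meanError_le_exp_mul (y := y) (S := Finset.univ) hx (hη t) hent
    have h3 := entrySum_vrEstimator_sub_le (y := y) hR hx hb hn hB hη hW (t + 1)
    -- The old error, relative to G at the old iterate, is transported to the new one by the factor
    -- exp(2R η_t).
    have heq : momentumBuffer β (vrEstimator x y m B W) (t + 1)
        - matrixGradient (empiricalLoss x y) (W (t + 1))
        = β • ((momentumBuffer β (vrEstimator x y m B W) t
              - matrixGradient (empiricalLoss x y) (W t))
            + (matrixGradient (batchLoss x y Finset.univ) (W t)
              - matrixGradient (batchLoss x y Finset.univ) (W (t + 1))))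
          + (1 - β) • (vrEstimator x y m B W (t + 1)
              - matrixGradient (empiricalLoss x y) (W (t + 1))) := by
      rw [momentumBuffer, empiricalLoss_eq_batchLoss]
      module
    rw [heq]
    refine (entrySum_add_le _ _).trans ?_
    rw [entrySum_smul, entrySum_smul, abs_of_nonneg hβ, abs_of_pos (sub_pos.2 hβ')]
    have h4 := (entrySum_add_le (momentumBuffer β (vrEstimator x y m B W) t
              - matrixGradient (empiricalLoss x y) (W t))
            (matrixGradient (batchLoss x y Finset.univ) (W t)
              - matrixGradient (batchLoss x y Finset.univ) (W (t + 1)))).trans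
      (add_le_add (ih.trans (mul_le_mul_of_nonneg_left h2
        (momentumError_nonneg hR hβ hβ' hη t))) h1)
    have h5 := mul_le_mul_of_nonneg_left h4 hβ
    have h6 := mul_le_mul_of_nonneg_left h3 (sub_pos.2 hβ').le
    refine (add_le_add h5 h6).trans (le_of_eq ?_)
    rw [momentumError]
    ring

lemma entrySum_descentSignal_sub_le (momentum : Bool) (hR : 0 ≤ R)
    (hx : ∀ i, ∑ j, |x i j| ≤ R) (hb : 1 ≤ b)
    (hn : n = m * b) (hB : ∀ t, (B t).card = b) (hβ : 0 ≤ β) (hβ' : β < 1)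
    (hη : ∀ t, 0 ≤ η t) (hW : ∀ t i j, |W (t + 1) i j - W t i j| ≤ η t) (t : ℕ) :
    entrySum (descentSignal momentum β (vrEstimator x y m B W) t
        - matrixGradient (empiricalLoss x y) (W t))
      ≤ signalError momentum R β m η t * meanError x y Finset.univ (W t) := by
  unfold descentSignal signalError
  cases momentum
  · exact entrySum_vrEstimator_sub_le hR hx hb hn hB hη hW t
  · exact entrySum_momentumBuffer_sub_le hR hx hb hn hB hβ hβ' hη hW t

end SignalError
open Filter Topology

/-! ### Step size asymptotics. -/

section StepSize

variable {a c η₀ : ℝ}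

lemma stepSize_of_pos {t : ℕ} (ht : 1 ≤ t) : stepSize a c η₀ t = c * (t : ℝ) ^ (-a) :=
  if_neg (by lia)

lemma stepSize_pos (hc : 0 < c) {t : ℕ} (ht : 1 ≤ t) : 0 < stepSize a c η₀ t := by
  rw [stepSize_of_pos ht]
  have : (0 : ℝ) < t := by exact_mod_cast ht
  positivity

lemma stepSize_nonneg (hc : 0 < c) (hη₀ : 0 ≤ η₀) (t : ℕ) : 0 ≤ stepSize a c η₀ t := by
  rcases Nat.eq_zero_or_pos t with rfl | ht
  · simpa [stepSize] using hη₀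
  · exact (stepSize_pos hc ht).le

lemma stepSize_le (ha : 0 < a) (hc : 0 < c) (hη₀' : η₀ ≤ c) (t : ℕ) :
    stepSize a c η₀ t ≤ c := by
  rcases Nat.eq_zero_or_pos t with rfl | ht
  · simpa [stepSize] using hη₀'
  · rw [stepSize_of_pos ht]
    exact mul_le_of_le_one_right hc.le
      (Real.rpow_le_one_of_one_le_of_nonpos (by exact_mod_cast ht) (by linarith))

/-- Since a ≤ 1, doubling the time at most halves the step. Late steps in one epoch are thus
comparable. -/
lemma stepSize_le_two_mul (ha : 0 < a) (ha' : a ≤ 1) (hc : 0 < c) {s t : ℕ} (hs : 1 ≤ s)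
    (ht : 1 ≤ t) (hst : t ≤ 2 * s) : stepSize a c η₀ s ≤ 2 * stepSize a c η₀ t := by
  rw [stepSize_of_pos hs, stepSize_of_pos ht, mul_left_comm]
  refine mul_le_mul_of_nonneg_left ?_ hc.le
  have hs' : (0 : ℝ) < s := by exact_mod_cast hs
  have ht' : (0 : ℝ) < t := by exact_mod_cast ht
  have h : (t : ℝ) ≤ 2 * s := by exact_mod_cast hst
  have h1 : (t : ℝ) ^ a ≤ 2 * (s : ℝ) ^ a :=
    calc (t : ℝ) ^ a ≤ (2 * s) ^ a := Real.rpow_le_rpow ht'.le h ha.le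
      _ = 2 ^ a * (s : ℝ) ^ a := Real.mul_rpow (by norm_num) hs'.le
      _ ≤ 2 ^ (1 : ℝ) * (s : ℝ) ^ a := by
          gcongr
          norm_num
      _ = _ := by rw [Real.rpow_one]
  rw [Real.rpow_neg hs'.le, Real.rpow_neg ht'.le, ← div_eq_mul_inv, ← one_div,
    div_le_div_iff₀ (by positivity) (by positivity)]
  linarith

lemma tendsto_stepSize (ha : 0 < a) : Tendsto (stepSize a c η₀) atTop (𝓝 0) := by
  have h : Tendsto (fun t : ℕ => c * (t : ℝ) ^ (-a)) atTop (𝓝 (c * 0)) :=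
    ((tendsto_rpow_neg_atTop ha).comp tendsto_natCast_atTop_atTop).const_mul c
  rw [mul_zero] at h
  refine h.congr' ?_
  filter_upwards [eventually_ge_atTop 1] with t ht
  rw [stepSize_of_pos ht]

lemma tendsto_sum_stepSize (ha' : a ≤ 1) (hc : 0 < c) (hη₀ : 0 ≤ η₀) :
    Tendsto (fun t => ∑ s ∈ Finset.range t, stepSize a c η₀ s) atTop atTop := by
  refine (not_summable_iff_tendsto_nat_atTop_of_nonneg (stepSize_nonneg hc hη₀)).1 ?_
  intro h
  have h1 : Summable fun t : ℕ => (t : ℝ) ^ (-a) := by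
    have h2 := (h.mul_left c⁻¹)
    rw [← summable_nat_add_iff 1] at h2 ⊢
    refine h2.congr fun t => ?_
    rw [stepSize_of_pos (by lia), inv_mul_cancel_left₀ hc.ne']
  rw [Real.summable_nat_rpow] at h1
  linarith

lemma tendsto_sum_Ico_stepSize (ha' : a ≤ 1) (hc : 0 < c) (hη₀ : 0 ≤ η₀) (t₁ : ℕ) :
    Tendsto (fun t => ∑ s ∈ Finset.Ico t₁ t, stepSize a c η₀ s) atTop atTop := by
  have h := tendsto_atTop_add_const_right atTop
    (-∑ s ∈ Finset.range t₁, stepSize a c η₀ s) (tendsto_sum_stepSize (a := a) ha' hc hη₀)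
  refine h.congr' ?_
  filter_upwards [eventually_ge_atTop t₁] with t ht
  rw [Finset.sum_Ico_eq_sub _ ht, sub_eq_add_neg]

lemma tendsto_stepSize_ratio (hc : 0 < c) :
    Tendsto (fun t => stepSize a c η₀ t / stepSize a c η₀ (t + 1)) atTop (𝓝 1) := by
  have h0 : Tendsto (fun t : ℕ => ((t : ℝ) / ((t : ℝ) + 1)) ^ (-a)) atTop (𝓝 (1 ^ (-a))) :=
    (tendsto_natCast_div_add_atTop (1 : ℝ)).rpow_const (Or.inl one_ne_zero)
  rw [Real.one_rpow] at h0
  refine h0.congr' ?_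
  filter_upwards [eventually_ge_atTop 1] with t ht
  rw [stepSize_of_pos ht, stepSize_of_pos (by lia), Real.div_rpow (by positivity)
    (by positivity), mul_div_mul_left _ _ hc.ne']
  push_cast
  rfl

end StepSize

lemma exp_sub_one_le_two_mul {u : ℝ} (h0 : 0 ≤ u) (h1 : u ≤ 1) : Real.exp u - 1 ≤ 2 * u := by
  have := Real.abs_exp_sub_one_le (x := u) (by rwa [abs_of_nonneg h0])
  rw [abs_of_nonneg h0] at this
  exact (abs_le.1 this).2

/-- A sequence that is eventually contracted up to a constant. -/
lemma eventually_le_of_contraction {f : ℕ → ℝ} {q A : ℝ} (hq0 : 0 ≤ q) (hq : q < 1) (hA : 0 < A)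
    (hf : ∀ᶠ t in atTop, f (t + 1) ≤ q * f t + A) :
    ∀ᶠ t in atTop, f t ≤ 2 * A / (1 - q) := by
  obtain ⟨T, hT⟩ := eventually_atTop.1 hf
  have h1q : 0 < 1 - q := sub_pos.2 hq
  have key : ∀ s, f (T + s) ≤ q ^ s * f T + A / (1 - q) - q ^ s * (A / (1 - q)) := by
    intro s
    induction s with
    | zero => simp
    | succ s ih =>
      have h1 := hT (T + s) (by lia)
      have h2 := mul_le_mul_of_nonneg_left ih hq0
      have h3 : A = A / (1 - q) - q * (A / (1 - q)) := by
        field_simp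
      rw [← add_assoc]
      refine h1.trans ?_
      rw [pow_succ]
      linarith
  have hlim : Tendsto (fun s : ℕ => q ^ s * f T) atTop (𝓝 (0 * f T)) :=
    (tendsto_pow_atTop_nhds_zero_of_lt_one hq0 hq).mul_const _
  rw [zero_mul] at hlim
  have hpos : 0 < A / (1 - q) := div_pos hA h1q
  have hev : ∀ᶠ s in atTop, f (T + s) ≤ 2 * A / (1 - q) := by
    filter_upwards [hlim.eventually (gt_mem_nhds hpos)] with s hs
    have h1 := key s
    have h2 : 0 ≤ q ^ s * (A / (1 - q)) := by positivity
    rw [mul_div_assoc]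
    linarith
  obtain ⟨s₀, hs₀⟩ := eventually_atTop.1 hev
  filter_upwards [eventually_ge_atTop (T + s₀)] with t ht
  have := hs₀ (t - T) (by lia)
  rwa [Nat.add_sub_cancel' (by lia)] at this

/-! ### The relative errors are eventually of the order of the step size. -/

section ErrorAsymptotics

variable {a c η₀ R β : ℝ} {m : ℕ}

/-- For t ≥ 2m the epoch starts after t - m ≥ t/2, so its fewer than m past steps are each at most 2
η_t. -/
lemma epochPath_stepSize_le (ha : 0 < a) (ha' : a ≤ 1) (hc : 0 < c) (hm : 1 ≤ m) {t : ℕ}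
    (ht : 2 * m ≤ t) :
    epochPath m (stepSize a c η₀) t ≤ 2 * m * stepSize a c η₀ t := by
  have hmod : t - m * (t / m) < m := by
    have := Nat.mod_lt t hm
    have := Nat.div_add_mod t m
    lia
  have hle := Nat.mul_div_le t m
  have h : ∀ s ∈ Finset.Ico (m * (t / m)) t,
      stepSize a c η₀ s ≤ 2 * stepSize a c η₀ t := fun s hs => by
    rw [Finset.mem_Ico] at hs
    exact stepSize_le_two_mul ha ha' hc (by lia) (by lia) (by lia)
  have hpos : 0 < stepSize a c η₀ t := stepSize_pos hc (by lia)
  refine (Finset.sum_le_card_nsmul _ _ _ h).trans ?_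
  rw [Nat.card_Ico, nsmul_eq_mul, mul_comm 2 (m : ℝ), mul_assoc]
  have : ((t - m * (t / m) : ℕ) : ℝ) ≤ m := by exact_mod_cast hmod.le
  gcongr

lemma eventually_vrError_le (ha : 0 < a) (ha' : a ≤ 1) (hc : 0 < c) (hη₀ : 0 ≤ η₀)
    (hR : 0 < R) (hm : 1 ≤ m) :
    ∀ᶠ t in atTop, vrError R m (stepSize a c η₀) t
      ≤ 32 * R ^ 2 * m ^ 2 * stepSize a c η₀ t := by
  have hm' : (1 : ℝ) ≤ m := by exact_mod_cast hm
  have hpos : 0 < 1 / (4 * R * m) := by positivity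
  filter_upwards [(tendsto_stepSize (c := c) (η₀ := η₀) ha).eventually (gt_mem_nhds hpos),
    eventually_ge_atTop (2 * m)] with t h1 ht
  have h2 := epochPath_stepSize_le (η₀ := η₀) ha ha' hc hm ht
  have h3 := epochPath_nonneg (m := m) (stepSize_nonneg (a := a) hc hη₀) t
  have hη := stepSize_nonneg (a := a) hc hη₀ t
  rw [lt_div_iff₀ (by positivity)] at h1
  have h4 : 2 * R * epochPath m (stepSize a c η₀) t ≤ 4 * R * m * stepSize a c η₀ t := by
    calc _ ≤ 2 * R * (2 * m * stepSize a c η₀ t) := by gcongr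
      _ = _ := by ring
  have h5 := exp_sub_one_le_two_mul (u := 2 * R * epochPath m (stepSize a c η₀) t)
    (by positivity) (by linarith)
  unfold vrError
  calc _ ≤ 2 * R * (m + m) * (2 * (4 * R * m * stepSize a c η₀ t)) := by
        refine mul_le_mul (by gcongr) (by linarith) ?_ (by positivity)
        exact sub_nonneg.2 (Real.one_le_exp (by positivity))
    _ = _ := by ring

/-- The ratio of the error to η_t is eventually contracted: its factor β exp(2R η_t) η_t/η_{t+1}
tends to β < (1 + β)/2. The additive term is 48 = 16 + 32 (drift plus fresh error), and 2 · 48 / ((1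
- β)/2) gives 192/(1 - β). -/
lemma eventually_momentumError_le (ha : 0 < a) (ha' : a ≤ 1) (hc : 0 < c) (hη₀ : 0 ≤ η₀)
    (hR : 0 < R) (hm : 1 ≤ m) (hβ : 0 ≤ β) (hβ' : β < 1) :
    ∀ᶠ t in atTop, momentumError R β m (stepSize a c η₀) t
      ≤ 192 * R ^ 2 * (m ^ 2 / (1 - β)) * stepSize a c η₀ t := by
  have hm' : (1 : ℝ) ≤ m := by exact_mod_cast hm
  have hβ1 : 0 < 1 - β := sub_pos.2 hβ'
  set η := stepSize a c η₀ with hηdef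
  have hη : ∀ t, 0 ≤ η t := stepSize_nonneg hc hη₀
  have hη0 : Tendsto η atTop (𝓝 0) := tendsto_stepSize ha
  have hratio : Tendsto (fun t => β * (Real.exp (2 * R * η t) * (η t / η (t + 1)))) atTop
      (𝓝 (β * (Real.exp (2 * R * 0) * 1))) :=
    (((Real.continuous_exp.tendsto _).comp (hη0.const_mul (2 * R))).mul
      (tendsto_stepSize_ratio hc)).const_mul β
  rw [mul_zero, Real.exp_zero, mul_one, mul_one] at hratio
  have hstep : ∀ᶠ t in atTop, momentumError R β m η (t + 1) / η (t + 1)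
      ≤ (1 + β) / 2 * (momentumError R β m η t / η t) + 48 * R ^ 2 * m ^ 2 := by
    filter_upwards [hratio.eventually (ge_mem_nhds (show β < (1 + β) / 2 by linarith)),
      hη0.eventually (gt_mem_nhds (show 0 < 1 / (2 * R) by positivity)),
      (tendsto_add_atTop_nat 1).eventually
        (eventually_vrError_le (η₀ := η₀) ha ha' hc hη₀ hR hm),
      eventually_ge_atTop 1] with t h1 h2 h3 ht
    have e0 := momentumError_nonneg (m := m) hR.le hβ hβ' hη t
    have p1 : 0 < η t := stepSize_pos hc ht
    have p2 : 0 < η (t + 1) := stepSize_pos hc (by lia)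
    have h4 : η t ≤ 2 * η (t + 1) := stepSize_le_two_mul ha ha' hc ht (by lia) (by lia)
    rw [lt_div_iff₀ (by positivity)] at h2
    have h5 := exp_sub_one_le_two_mul (u := 2 * R * η t) (by positivity) (by linarith)
    have h6 : β * (Real.exp (2 * R * η t) * momentumError R β m η t)
        ≤ (1 + β) / 2 * (momentumError R β m η t / η t) * η (t + 1) := by
      have h := mul_le_mul_of_nonneg_right h1
        (mul_nonneg (div_nonneg e0 p1.le) p2.le)
      calc _ = _ := by field_simp
        _ ≤ _ := h
        _ = _ := by ring
    have h7 : β * (2 * R * (Real.exp (2 * R * η t) - 1)) ≤ 16 * R ^ 2 * m ^ 2 * η (t + 1) := by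
      calc _ ≤ 1 * (2 * R * (2 * (2 * R * (2 * η (t + 1))))) := by
            refine mul_le_mul hβ'.le ?_ ?_ (by norm_num)
            · have : 2 * R * η t ≤ 2 * R * (2 * η (t + 1)) := by gcongr
              exact mul_le_mul_of_nonneg_left (by linarith) (by positivity)
            · exact mul_nonneg (by positivity)
                (sub_nonneg.2 (Real.one_le_exp (by positivity)))
        _ = 16 * R ^ 2 * 1 * η (t + 1) := by ring
        _ ≤ _ := by
            gcongr
            exact one_le_pow₀ hm'
    have h8 : (1 - β) * vrError R m η (t + 1) ≤ 32 * R ^ 2 * m ^ 2 * η (t + 1) :=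
      (mul_le_of_le_one_left (vrError_nonneg hR.le hη _) (by linarith)).trans h3
    rw [div_le_iff₀ p2, momentumError]
    linarith
  have hfin := eventually_le_of_contraction (f := fun t => momentumError R β m η t / η t)
    (q := (1 + β) / 2) (by linarith) (by linarith)
    (show 0 < 48 * R ^ 2 * (m : ℝ) ^ 2 by positivity) hstep
  filter_upwards [hfin, eventually_ge_atTop 1] with t h1 ht
  have p1 : 0 < η t := stepSize_pos hc ht
  rw [div_le_iff₀ p1] at h1
  refine h1.trans (le_of_eq ?_)
  have : 1 - (1 + β) / 2 = (1 - β) / 2 := by ring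
  rw [this]
  field_simp
  ring

/-- The error analysis needs only m²; this passes to the exponent in `noiseCoeff`. -/
lemma sq_le_rpow_two_add (ha : 0 < a) (hm : 1 ≤ m) : (m : ℝ) ^ 2 ≤ (m : ℝ) ^ (2 + a) := by
  rw [← Real.rpow_natCast]
  exact Real.rpow_le_rpow_of_exponent_le (by exact_mod_cast hm) (by push_cast; linarith)

lemma one_le_noiseCoeff (momentum : Bool) (ha : 0 < a) (hm : 1 ≤ m) (hβ : 0 ≤ β)
    (hβ' : β < 1) : 1 ≤ noiseCoeff momentum a β m := by
  have h : (1 : ℝ) ≤ (m : ℝ) ^ (2 + a) :=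
    Real.one_le_rpow (by exact_mod_cast hm) (by linarith)
  cases momentum
  · simpa [noiseCoeff] using h
  · simp only [noiseCoeff, if_true]
    rw [le_div_iff₀ (sub_pos.2 hβ')]
    linarith

lemma eventually_signalError_le (momentum : Bool) (ha : 0 < a) (ha' : a ≤ 1) (hc : 0 < c)
    (hη₀ : 0 ≤ η₀) (hR : 0 < R) (hm : 1 ≤ m) (hβ : 0 ≤ β) (hβ' : β < 1) :
    ∀ᶠ t in atTop, signalError momentum R β m (stepSize a c η₀) t
      ≤ 192 * R ^ 2 * noiseCoeff momentum a β m * stepSize a c η₀ t := by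
  have hβ1 : 0 < 1 - β := sub_pos.2 hβ'
  have hm2 := sq_le_rpow_two_add (m := m) ha hm
  cases momentum
  · filter_upwards [eventually_vrError_le (η₀ := η₀) ha ha' hc hη₀ hR hm] with t h
    have hη := stepSize_nonneg (a := a) hc hη₀ t
    simp only [signalError, noiseCoeff, Bool.false_eq_true, if_false]
    refine h.trans ?_
    gcongr
    norm_num
  · filter_upwards [eventually_momentumError_le (η₀ := η₀) ha ha' hc hη₀ hR hm hβ hβ'] with t h
    have hη := stepSize_nonneg (a := a) hc hη₀ t
    simp only [signalError, noiseCoeff, if_true]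
    refine h.trans ?_
    gcongr

end ErrorAsymptotics

/-! ### The scalar loss recursion. -/

section Recursion

variable {L G η : ℕ → ℝ} {γ κ ν : ℝ}

/-- Telescoping: if the loss decreases in proportion to `G`, then `G` is small at some time in
every long enough window, and so is the loss from then on. -/
lemma loss_le_of_window {θ : ℝ} {t₁ t₂ : ℕ} (hη : ∀ t, 0 ≤ η t) (hγ : 0 ≤ γ)
    (hG : ∀ t, 0 ≤ G t) (hL : ∀ t, 0 ≤ L t)
    (hdesc : ∀ t, t₁ ≤ t → L (t + 1) ≤ L t - γ * η t * G t)
    (hwin : L t₁ < γ * θ * ∑ s ∈ Finset.Ico t₁ t₂, η s)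
    (hLG : ∀ t, G t ≤ θ → L t ≤ 2 * G t) {t : ℕ} (ht : t₂ ≤ t) : L t ≤ 2 * θ := by
  have hmono : ∀ s t, t₁ ≤ s → s ≤ t → L t ≤ L s := by
    intro s t hs hst
    induction t, hst using Nat.le_induction with
    | base => exact le_rfl
    | succ t hst ih =>
      have h1 := hdesc t (hs.trans hst)
      have h2 : 0 ≤ γ * η t * G t := mul_nonneg (mul_nonneg hγ (hη t)) (hG t)
      linarith
  have hle : t₁ ≤ t₂ := by
    by_contra h
    rw [Finset.Ico_eq_empty_of_le (by lia)] at hwin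
    simp only [Finset.sum_empty, mul_zero] at hwin
    linarith [hL t₁]
  have hex : ∃ s, t₁ ≤ s ∧ s < t₂ ∧ G s ≤ θ := by
    by_contra! hcon
    have key : ∀ t, t₁ ≤ t → t ≤ t₂ →
        L t ≤ L t₁ - γ * θ * ∑ s ∈ Finset.Ico t₁ t, η s := by
      intro t ht
      induction t, ht using Nat.le_induction with
      | base => simp
      | succ t ht ih =>
        intro ht'
        have h1 := hdesc t ht
        have h2 := ih (by lia)
        have h3 := mul_le_mul_of_nonneg_left (hcon t ht (by lia)).le (mul_nonneg hγ (hη t))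
        rw [Finset.sum_Ico_succ_top ht]
        linarith
    linarith [key t₂ hle le_rfl, hL t₂]
  obtain ⟨s, hs1, hs2, hs3⟩ := hex
  linarith [hmono s t hs1 (by lia), hLG s hs3]

/-- Exponential decay of the loss, with the sharp rate `γ`. -/
lemma loss_decay {t₂ : ℕ} (hη : ∀ t, 0 ≤ η t) (hγ : 0 ≤ γ) (hκ : 0 ≤ κ) (hν : 0 ≤ ν)
    (hL : ∀ t, 0 ≤ L t)
    (hdesc : ∀ t, t₂ ≤ t → L (t + 1) ≤ L t - η t * (γ - κ * η t) * G t)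
    (hsmall : ∀ t, t₂ ≤ t → κ * η t ≤ γ / 2)
    (hLν : ∀ t, t₂ ≤ t → ν * L t ≤ 1 / 2)
    (hLG : ∀ t, t₂ ≤ t → L t ≤ 2 * G t)
    (hLG' : ∀ t, t₂ ≤ t → L t * (1 - ν * L t) ≤ G t) {t : ℕ} (ht : t₂ ≤ t) :
    L t ≤ L t₂ * Real.exp (-(γ * ∑ s ∈ Finset.Ico t₂ t, η s)
      + κ * ∑ s ∈ Finset.Ico t₂ t, η s ^ 2
      + γ * ∑ s ∈ Finset.Ico t₂ t,
          η s * Real.exp (-(γ / 4) * ∑ τ ∈ Finset.Ico t₂ s, η τ)) := by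
  -- A first pass with rate γ/4: one factor 2 is lost to κ η ≤ γ/2, one to L ≤ 2G. It serves only to
  -- bound the defect ν L in the sharp second pass.
  have hcrude : ∀ t, t₂ ≤ t →
      L t ≤ L t₂ * Real.exp (-(γ / 4) * ∑ τ ∈ Finset.Ico t₂ t, η τ) := by
    intro t ht
    induction t, ht using Nat.le_induction with
    | base => simp
    | succ t ht ih =>
      have h1 : η t * (γ / 2) * (L t / 2) ≤ η t * (γ - κ * η t) * G t := by
        refine mul_le_mul ?_ (by linarith [hLG t ht]) (by linarith [hL t])
          (mul_nonneg (hη t) (by linarith [hsmall t ht]))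
        exact mul_le_mul_of_nonneg_left (by linarith [hsmall t ht]) (hη t)
      have h2 : L (t + 1) ≤ L t * (-(γ / 4) * η t + 1) := by linarith [hdesc t ht]
      rw [Finset.sum_Ico_succ_top ht, mul_add, Real.exp_add, ← mul_assoc]
      calc L (t + 1) ≤ L t * (-(γ / 4) * η t + 1) := h2
        _ ≤ L t * Real.exp (-(γ / 4) * η t) :=
            mul_le_mul_of_nonneg_left (Real.add_one_le_exp _) (hL t)
        _ ≤ _ := mul_le_mul_of_nonneg_right ih (Real.exp_pos _).le
  induction t, ht using Nat.le_induction with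
  | base => simp
  | succ t ht ih =>
    set E := Real.exp (-(γ / 4) * ∑ τ ∈ Finset.Ico t₂ t, η τ) with hE
    have hνE : ν * L t ≤ E := by
      have h1 := mul_le_mul_of_nonneg_left (hcrude t ht) hν
      rw [← mul_assoc] at h1
      exact h1.trans (mul_le_of_le_one_left (Real.exp_pos _).le (by linarith [hLν t₂ le_rfl]))
    have hρ : 0 ≤ κ * η t := mul_nonneg hκ (hη t)
    have h1 : η t * (γ - κ * η t) * (L t * (1 - ν * L t)) ≤ η t * (γ - κ * η t) * G t :=
      mul_le_mul_of_nonneg_left (hLG' t ht)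
        (mul_nonneg (hη t) (by linarith [hsmall t ht]))
    have h2 : γ - κ * η t - γ * E ≤ (γ - κ * η t) * (1 - ν * L t) := by
      have h3 : γ * (ν * L t) ≤ γ * E := mul_le_mul_of_nonneg_left hνE hγ
      have h4 : 0 ≤ κ * η t * (ν * L t) := mul_nonneg hρ (mul_nonneg hν (hL t))
      linarith
    have h3 := mul_le_mul_of_nonneg_left h2 (mul_nonneg (hη t) (hL t))
    have h4 : L (t + 1) ≤ L t * ((-(γ * η t) + κ * η t ^ 2 + γ * (η t * E)) + 1) := by
      linarith [hdesc t ht]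
    rw [Finset.sum_Ico_succ_top ht, Finset.sum_Ico_succ_top ht, Finset.sum_Ico_succ_top ht]
    calc L (t + 1) ≤ _ := h4
      _ ≤ L t * Real.exp (-(γ * η t) + κ * η t ^ 2 + γ * (η t * E)) :=
          mul_le_mul_of_nonneg_left (Real.add_one_le_exp _) (hL t)
      _ ≤ _ := mul_le_mul_of_nonneg_right ih (Real.exp_pos _).le
      _ = _ := by
          rw [mul_assoc, ← Real.exp_add]
          congr 2
          ring

end Recursion

/-! ### The rate tends to zero. -/

section Limit

variable {a c η₀ : ℝ}

/-- A Cesàro argument: weighted averages of a null sequence vanish because the weights have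
divergent sum. -/
lemma isLittleO_sum_Ico_stepSize (ha' : a ≤ 1) (hc : 0 < c) (hη₀ : 0 ≤ η₀) {ω : ℕ → ℝ}
    (hω : Tendsto ω atTop (𝓝 0)) (t₂ : ℕ) :
    (fun t => ∑ s ∈ Finset.Ico t₂ t, stepSize a c η₀ s * ω s)
      =o[atTop] fun t => ∑ s ∈ Finset.range t, stepSize a c η₀ s := by
  have hS := tendsto_sum_stepSize (a := a) ha' hc hη₀
  have h1 : (fun t => stepSize a c η₀ t * ω t) =o[atTop] stepSize a c η₀ := by
    have := (Asymptotics.isBigO_refl (stepSize a c η₀) atTop).mul_isLittleO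
      ((Asymptotics.isLittleO_one_iff ℝ).2 hω)
    simpa using this
  have h2 := h1.sum_range (fun t => stepSize_nonneg hc hη₀ t) hS
  have h3 : (fun _ : ℕ => ∑ s ∈ Finset.range t₂, stepSize a c η₀ s * ω s)
      =o[atTop] fun t => ∑ s ∈ Finset.range t, stepSize a c η₀ s :=
    Asymptotics.isLittleO_const_left.2 (Or.inr (tendsto_norm_atTop_atTop.comp hS))
  refine (h2.sub h3).congr' ?_ EventuallyEq.rfl
  filter_upwards [eventually_ge_atTop t₂] with t ht
  rw [Finset.sum_Ico_eq_sub _ ht]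

lemma tendsto_rate_zero (ha : 0 < a) (ha' : a ≤ 1) (hc : 0 < c) (hη₀ : 0 ≤ η₀) {γ : ℝ}
    (hγ : 0 < γ) (P K D : ℝ) (t₂ : ℕ) :
    Tendsto (fun t => (P + K * ∑ s ∈ Finset.Ico t₂ t, stepSize a c η₀ s ^ 2
      + ∑ s ∈ Finset.Ico t₂ t, stepSize a c η₀ s *
          Real.exp (-(γ / 4) * ∑ τ ∈ Finset.Ico t₂ s, stepSize a c η₀ τ) + D)
      / ∑ s ∈ Finset.range t, stepSize a c η₀ s) atTop (𝓝 0) := by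
  have hS := tendsto_sum_stepSize (a := a) ha' hc hη₀
  have hconst : ∀ r : ℝ, (fun _ : ℕ => r)
      =o[atTop] fun t => ∑ s ∈ Finset.range t, stepSize a c η₀ s := fun r =>
    Asymptotics.isLittleO_const_left.2 (Or.inr (tendsto_norm_atTop_atTop.comp hS))
  have h1 := isLittleO_sum_Ico_stepSize (a := a) (η₀ := η₀) ha' hc hη₀
    (tendsto_stepSize (a := a) (c := c) (η₀ := η₀) ha) t₂
  have h2 := isLittleO_sum_Ico_stepSize (a := a) (η₀ := η₀) ha' hc hη₀
    (Real.tendsto_exp_atBot.comp ((tendsto_sum_Ico_stepSize (a := a) (η₀ := η₀) ha' hc hη₀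
      t₂).const_mul_atTop_of_neg (show -(γ / 4) < 0 by linarith))) t₂
  have h3 := (((hconst P).add (h1.const_mul_left K)).add h2).add (hconst D)
  simpa only [sq, Function.comp_def] using h3.tendsto_div_nhds_zero

end Limit

/-! ### One-step descent, and the theorem. -/

section Descent

variable {n m b k d : ℕ} {N : Matrix (Fin k) (Fin d) ℝ → ℝ} {x : Fin n → Fin d → ℝ}
  {y : Fin n → Fin k} {B : ℕ → Finset (Fin n)} {η : ℕ → ℝ} {momentum : Bool} {β R c : ℝ}
  {W : ℕ → Matrix (Fin k) (Fin d) ℝ}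

lemma IsVRSteepestDescent.abs_entry_step_le (hN : IsEntryNorm N) (hη : ∀ t, 0 ≤ η t)
    (hW : IsVRSteepestDescent N x y m B η momentum β W) (t : ℕ) (i : Fin k) (j : Fin d) :
    |W (t + 1) i j - W t i j| ≤ η t := by
  obtain ⟨D, hD, hstep⟩ := hW t
  rw [hstep]
  simp only [Matrix.sub_apply, Matrix.smul_apply, smul_eq_mul, sub_sub_cancel_left, abs_neg,
    abs_mul, abs_of_nonneg (hη t)]
  exact mul_le_of_le_one_right (hη t) ((hN.abs_entry_le D i j).trans hD.1)

lemma IsVRSteepestDescent.norm_le (hN : IsEntryNorm N) (hη : ∀ t, 0 ≤ η t)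
    (hW : IsVRSteepestDescent N x y m B η momentum β W) (t : ℕ) :
    N (W t) ≤ N (W 0) + ∑ s ∈ Finset.range t, η s := by
  induction t with
  | zero => simp
  | succ t ih =>
    obtain ⟨D, hD, hstep⟩ := hW t
    rw [hstep, Finset.sum_range_succ, sub_eq_add_neg, ← neg_smul]
    have h1 := hN.add_le (W t) (-η t • D)
    rw [hN.smul, abs_neg, abs_of_nonneg (hη t)] at h1
    linarith [mul_le_of_le_one_right (hη t) hD.1]

lemma IsVRSteepestDescent.loss_step_le (hN : IsEntryNorm N) (hn0 : 0 < n) (hk : 2 ≤ k)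
    (hR : 0 ≤ R) (hx : ∀ i, ∑ j, |x i j| ≤ R) (hb : 1 ≤ b) (hn : n = m * b)
    (hB : ∀ t, (B t).card = b) (hβ : 0 ≤ β) (hβ' : β < 1) (hη : ∀ t, 0 ≤ η t)
    (hηc : ∀ t, η t ≤ c) (hW : IsVRSteepestDescent N x y m B η momentum β W) {κ : ℝ} {t : ℕ}
    (hκ : 2 * signalError momentum R β m η t + 4 * R ^ 2 * Real.exp (2 * R * c) * η t
      ≤ κ * η t) :
    empiricalLoss x y (W (t + 1)) ≤ empiricalLoss x y (W t)
      - η t * (maxMargin N x y - κ * η t) * meanError x y Finset.univ (W t) := by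
  have herr := entrySum_descentSignal_sub_le (y := y) momentum hR hx hb hn hB hβ hβ' hη
    (hW.abs_entry_step_le hN hη) t
  obtain ⟨D, hD, hstep⟩ := hW t
  have h1 := matrixInner_steepest_ge hN hn0 hk hD herr
  have h2 := batchLoss_sub_smul_le (y := y) hx (hη t)
    (fun i j => (hN.abs_entry_le D i j).trans hD.1) Finset.univ (W t)
  rw [← empiricalLoss_eq_batchLoss, ← hstep] at h2
  have hG := meanError_nonneg x y Finset.univ (W t)
  have h3 := mul_le_mul_of_nonneg_left h1 (hη t)
  have h4 : 4 * (R * η t) ^ 2 * Real.exp (2 * (R * η t))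
      ≤ η t * (4 * R ^ 2 * Real.exp (2 * R * c) * η t) := by
    have : Real.exp (2 * (R * η t)) ≤ Real.exp (2 * R * c) := by
      rw [Real.exp_le_exp, mul_assoc]
      have := mul_le_mul_of_nonneg_left (hηc t) hR
      linarith
    calc _ ≤ 4 * (R * η t) ^ 2 * Real.exp (2 * R * c) := by gcongr
      _ = _ := by ring
  have h5 := mul_le_mul_of_nonneg_right h4 hG
  have h6 := mul_le_mul_of_nonneg_right (mul_le_mul_of_nonneg_left hκ (hη t)) hG
  linarith

end Descent

/-- From a bound on the margin deficit to a bound on the normalized margin. -/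
lemma sub_div_le_of_deficit {γ R μ ν Q S : ℝ} (hγ : 0 < γ) (hR : 0 < R) (hS : 0 < S)
    (hQ : 0 ≤ Q) (hμ : 0 ≤ μ) (hν : 0 < ν) (hμν : μ ≤ 2 * R * ν) (h1 : γ * S - Q ≤ μ)
    (h2 : γ * ν - μ ≤ Q) : γ - μ / ν ≤ (4 * R / γ + 2) * (Q / S) := by
  have hQS : 0 ≤ Q / S := div_nonneg hQ hS.le
  -- If Q is small, then γS/2 ≤ μ ≤ 2Rν, so ν is at least of order S and can replace it as
  -- denominator. Otherwise γ itself is at most 2Q/S.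
  by_cases hcase : Q ≤ γ * S / 2
  · have h3 : γ * S ≤ 4 * R * ν := by linarith
    have h4 : γ - μ / ν ≤ Q / ν := by
      rw [le_div_iff₀ hν, sub_mul, div_mul_cancel₀ _ hν.ne']
      exact h2
    have h5 : Q / ν ≤ 4 * R / γ * (Q / S) := by
      rw [div_mul_div_comm, div_le_div_iff₀ hν (by positivity)]
      have := mul_le_mul_of_nonneg_left h3 hQ
      linarith
    linarith
  · have h3 : γ ≤ 2 * (Q / S) := by
      rw [← mul_div_assoc, le_div_iff₀ hS]
      linarith
    have h4 : 0 ≤ μ / ν := div_nonneg hμ hν.le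
    have h5 : 0 ≤ 4 * R / γ * (Q / S) := mul_nonneg (by positivity) hQS
    linarith

lemma driftConst_nonneg (momentum : Bool) {R η₀ β : ℝ} (hR : 0 ≤ R) (hη₀ : 0 ≤ η₀)
    (hβ' : β < 1) : 0 ≤ driftConst momentum R η₀ β := by
  unfold driftConst
  split_ifs
  · have : Real.sqrt β ≤ 1 := Real.sqrt_le_one.2 hβ'.le
    exact div_nonneg (by positivity) (by linarith)
  · exact le_rfl

theorem theorem4p6 (a c η₀ R γ : ℝ) (ha : 0 < a) (ha' : a ≤ 1) (hc : 0 < c)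
    (hη₀ : 0 ≤ η₀) (hη₀' : η₀ ≤ c) (hR : 0 < R) :
    ∃ C : ℝ, 0 < C ∧
      ∀ (n m b k d : ℕ), 1 ≤ m → 1 ≤ b → n = m * b → 2 ≤ k →
      ∀ (momentum : Bool) (β : ℝ), 0 ≤ β → β < 1 →
      ∀ W₀ : Matrix (Fin k) (Fin d) ℝ,
      ∃ t₂ : ℕ, 1 ≤ t₂ ∧
        ∀ (F : MatrixNormFamily) (p : ENNReal), 1 ≤ p →
        ∀ (x : Fin n → Fin d → ℝ) (y : Fin n → Fin k),
          LinearlySeparable x y →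
          (∀ i, ∑ j, |x i j| ≤ R) →
          maxMargin (matrixNorm F p) x y = γ →
        ∀ B : ℕ → Finset (Fin n), IsReshuffling m b B →
        ∀ W : ℕ → Matrix (Fin k) (Fin d) ℝ, W 0 = W₀ →
          IsVRSteepestDescent (matrixNorm F p) x y m B (stepSize a c η₀) momentum β W →
          (∀ t : ℕ, t₂ < t →
            empiricalLoss x y (W t) ≤ Real.log 2 / n ∧
            W t ≠ 0 ∧
            γ - minMargin x y (W t) / matrixNorm F p (W t) ≤
              C * ((∑ s ∈ Finset.range t₂, stepSize a c η₀ s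
                  + noiseCoeff momentum a β m * ∑ s ∈ Finset.Ico t₂ t, stepSize a c η₀ s ^ 2
                  + ∑ s ∈ Finset.Ico t₂ t, stepSize a c η₀ s *
                      Real.exp (-(γ / 4) * ∑ τ ∈ Finset.Ico t₂ s, stepSize a c η₀ τ)
                  + driftConst momentum R η₀ β)
                / ∑ s ∈ Finset.range t, stepSize a c η₀ s)) ∧
          Filter.Tendsto (fun t => minMargin x y (W t) / matrixNorm F p (W t))
            Filter.atTop (nhds γ) := by
  -- Separable data have positive margin, so γ ≤ 0 is vacuous.
  by_cases hγ : 0 < γ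
  swap
  · refine ⟨1, one_pos, fun n m b k d hm hb hn hk _ _ _ _ _ => ⟨1, le_rfl, ?_⟩⟩
    intro F p hp x y hsep hx hmar
    have hn0 : 0 < n := by rw [hn]; exact Nat.mul_pos hm hb
    exact absurd (hmar ▸ maxMargin_pos (isEntryNorm_matrixNorm F hp) hn0 hk hR hx hsep) hγ
  -- 384 = 2 · 192 comes from the signal error, counted twice in the descent; the other term is the
  -- curvature of the loss.
  set K : ℝ := 384 * R ^ 2 + 4 * R ^ 2 * Real.exp (2 * R * c) with hK
  have hKpos : 0 < K := by positivity
  refine ⟨(4 * R / γ + 2) * (2 * γ + K), by positivity, ?_⟩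
  intro n m b k d hm hb hn hk momentum β hβ hβ' W₀
  have hn0 : 0 < n := by rw [hn]; exact Nat.mul_pos hm hb
  have hnR : (0 : ℝ) < n := by exact_mod_cast hn0
  set η := stepSize a c η₀ with hηdef
  have hη : ∀ t, 0 ≤ η t := stepSize_nonneg hc hη₀
  have hηc : ∀ t, η t ≤ c := stepSize_le ha hc hη₀'
  set Cm := noiseCoeff momentum a β m with hCm
  have hCm1 : 1 ≤ Cm := one_le_noiseCoeff momentum ha hm hβ hβ'
  have hKC : 0 < K * Cm := by positivity
  -- From `t₁` on the signal error is O(η_t) and the relative loss of descent is at most one half.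
  -- Only sequences free of the data enter.
  obtain ⟨t₁, ht₁⟩ := eventually_atTop.1
    ((eventually_signalError_le (η₀ := η₀) momentum ha ha' hc hη₀ hR hm hβ hβ').and
      ((tendsto_stepSize (c := c) (η₀ := η₀) ha).eventually
        (gt_mem_nhds (show 0 < γ / 2 / (K * Cm) by positivity))))
  set Lbar : ℝ := Real.log k + 2 * (R * (entrySum W₀ + ∑ s ∈ Finset.range t₁, η s)) with hLbar
  -- The window from `t₁` to `t₂` is long enough to use up any loss below `Lbar`. The step sum
  -- before `t₂` also dominates `entrySum W₀`, so the initial norm is absorbed and `C` does not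
  -- depend on `W₀`.
  obtain ⟨t₂, ht₂a, ht₂b, ht₂c, ht₂d⟩ :=
    (((tendsto_sum_Ico_stepSize (a := a) ha' hc hη₀ t₁).const_mul_atTop
        (show 0 < γ / 2 * (1 / (8 * n)) by positivity)).eventually_gt_atTop Lbar |>.and
      (((tendsto_sum_stepSize (a := a) ha' hc hη₀).eventually_ge_atTop (entrySum W₀)).and
        ((eventually_ge_atTop 1).and (eventually_ge_atTop t₁)))).exists
  refine ⟨t₂, ht₂c, ?_⟩
  intro F p hp x y hsep hx hmar B hB W hW0 hW
  set N := matrixNorm (k := k) (d := d) F p with hNdef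
  have hN : IsEntryNorm N := isEntryNorm_matrixNorm F hp
  set L : ℕ → ℝ := fun t => empiricalLoss x y (W t) with hL
  set G : ℕ → ℝ := fun t => meanError x y Finset.univ (W t) with hG
  have hGpos : ∀ t, 0 < G t := fun t => meanError_pos hn0 hk x y (W t)
  have hLpos : ∀ t, 0 < L t := fun t => (hGpos t).trans_le (meanError_le_empiricalLoss x y _)
  have hsmall : ∀ t, t₁ ≤ t → K * Cm * η t ≤ γ / 2 := fun t ht => by
    have h := (ht₁ t ht).2.le
    rw [le_div_iff₀ hKC] at h
    linarith
  have hdesc : ∀ t, t₁ ≤ t → L (t + 1) ≤ L t - η t * (γ - K * Cm * η t) * G t := by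
    intro t ht
    have h := (ht₁ t ht).1
    rw [← hmar]
    refine hW.loss_step_le hN hn0 hk hR.le hx hb hn hB.1 hβ hβ' hη hηc ?_
    have h1 : 4 * R ^ 2 * Real.exp (2 * R * c) * η t * 1
        ≤ 4 * R ^ 2 * Real.exp (2 * R * c) * η t * Cm :=
      mul_le_mul_of_nonneg_left hCm1 (mul_nonneg (by positivity) (hη t))
    rw [hK]
    linarith
  have hNW : ∀ t, N (W t) ≤ entrySum W₀ + ∑ s ∈ Finset.range t, η s := fun t => by
    have h1 := hW.norm_le hN hη t
    have h2 := hN.le_sum W₀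
    rw [hW0] at h1
    exact h1.trans (add_le_add_left h2 _)
  have hSnn : ∀ t, 0 ≤ ∑ s ∈ Finset.range t, η s := fun t => Finset.sum_nonneg fun s _ => hη s
  have hLt₁ : L t₁ ≤ Lbar :=
    empiricalLoss_le_log_card_add hn0 (add_nonneg (entrySum_nonneg _) (hSnn _)) hx
      fun i j => (hN.abs_entry_le _ i j).trans (hNW t₁)
  have hLsmall : ∀ t, t₂ ≤ t → n * L t ≤ 1 / 4 := by
    intro t ht
    -- The threshold 1/(8n) makes every sample probability at least 1/2, and 2θ yields n L ≤ 1/4.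
    have h := loss_le_of_window (L := L) (G := G) (γ := γ / 2) (θ := 1 / (8 * n)) (t₁ := t₁)
      hη (by positivity) (fun t => (hGpos t).le) (fun t => (hLpos t).le)
      (fun t ht => ?_) (hLt₁.trans_lt ht₂a) (fun t ht => ?_) ht
    · calc n * L t ≤ n * (2 * (1 / (8 * n))) := by gcongr
        _ = 1 / 4 := by field_simp; norm_num
    · have h1 : η t * (γ / 2) * G t ≤ η t * (γ - K * Cm * η t) * G t :=
        mul_le_mul_of_nonneg_right
          (mul_le_mul_of_nonneg_left (by linarith [hsmall t ht]) (hη t)) (hGpos t).le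
      linarith [hdesc t ht]
    · refine empiricalLoss_le_two_mul_meanError (half_le_softmaxProb_of_meanError hn0 ?_)
      calc n * G t ≤ n * (1 / (8 * n)) := by gcongr
        _ = 1 / 8 := by field_simp
        _ ≤ 1 / 4 := by norm_num
  have hmarpos : ∀ t, t₂ ≤ t → 0 < minMargin x y (W t) := by
    intro t ht
    refine lt_of_lt_of_le ?_ (neg_log_le_minMargin hn0 hk (by linarith [hLsmall t ht]))
    rw [neg_pos]
    exact Real.log_neg (mul_pos two_pos (mul_pos hnR (hLpos t))) (by linarith [hLsmall t ht])
  have hNpos : ∀ t, t₂ ≤ t → 0 < N (W t) := fun t ht =>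
    pos_of_mul_pos_right ((hmarpos t ht).trans_le (minMargin_le_two_mul hN hn0 hk hx (W t)))
      (by linarith)
  have hmain : ∀ t, t₂ < t →
      γ - minMargin x y (W t) / N (W t) ≤
        (4 * R / γ + 2) * (2 * γ + K) * ((∑ s ∈ Finset.range t₂, η s
          + Cm * ∑ s ∈ Finset.Ico t₂ t, η s ^ 2
          + ∑ s ∈ Finset.Ico t₂ t, η s *
              Real.exp (-(γ / 4) * ∑ τ ∈ Finset.Ico t₂ s, η τ)
          + driftConst momentum R η₀ β) / ∑ s ∈ Finset.range t, η s) := by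
    intro t ht
    set P := ∑ s ∈ Finset.range t₂, η s with hP
    set S := ∑ s ∈ Finset.range t, η s with hS
    set X := ∑ s ∈ Finset.Ico t₂ t, η s ^ 2 with hX
    set Y := ∑ s ∈ Finset.Ico t₂ t, η s *
              Real.exp (-(γ / 4) * ∑ τ ∈ Finset.Ico t₂ s, η τ) with hY
    have hXnn : 0 ≤ Cm * X := mul_nonneg (by linarith)
      (Finset.sum_nonneg fun s _ => sq_nonneg _)
    have hYnn : 0 ≤ Y :=
      Finset.sum_nonneg fun s _ => mul_nonneg (hη s) (Real.exp_pos _).le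
    have hDnn := driftConst_nonneg momentum (β := β) hR.le hη₀ hβ'
    have hPnn : 0 ≤ P := hSnn t₂
    have hSpos : 0 < S := by
      refine Finset.sum_pos' (fun s _ => hη s) ⟨1, Finset.mem_range.2 (by lia), ?_⟩
      exact stepSize_pos hc le_rfl
    have hdec := loss_decay (L := L) (G := G) (κ := K * Cm) (ν := n) (t₂ := t₂) hη hγ.le hKC.le
      hnR.le (fun t => (hLpos t).le) (fun t ht => hdesc t (ht₂d.trans ht))
      (fun t ht => hsmall t (ht₂d.trans ht)) (fun t ht => by linarith [hLsmall t ht])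
      (fun t ht => empiricalLoss_le_two_mul_meanError
        (half_le_softmaxProb_of_loss hn0 (by linarith [hLsmall t ht])))
      (fun t ht => mul_one_sub_le_meanError hn0 (by linarith [hLsmall t ht])) ht.le
    rw [Finset.sum_Ico_eq_sub _ ht.le] at hdec
    have hmarlow : γ * (S - P) - K * Cm * X - γ * Y ≤ minMargin x y (W t) := by
      have h1 := neg_log_le_minMargin hn0 hk
        (show n * empiricalLoss x y (W t) ≤ 1 by linarith [hLsmall t ht.le])
      have h2 : 2 * (n * L t) ≤ Real.exp (-(γ * (S - P)) + K * Cm * X + γ * Y) := by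
        calc 2 * (n * L t) ≤ 2 * (n * (L t₂ * _)) := by gcongr
          _ = (2 * (n * L t₂)) * _ := by ring
          _ ≤ _ := mul_le_of_le_one_left (Real.exp_pos _).le
              (by linarith [hLsmall t₂ le_rfl])
      have h3 := Real.log_le_log (mul_pos two_pos (mul_pos hnR (hLpos t))) h2
      rw [Real.log_exp] at h3
      linarith
    have hprod1 : 0 ≤ γ * P := mul_nonneg hγ.le hPnn
    have hprod2 : 0 ≤ K * P := mul_nonneg hKpos.le hPnn
    have hprod3 : 0 ≤ γ * (Cm * X) := mul_nonneg hγ.le hXnn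
    have hprod4 : 0 ≤ γ * Y := mul_nonneg hγ.le hYnn
    have hprod5 : 0 ≤ K * Y := mul_nonneg hKpos.le hYnn
    have hprod6 : 0 ≤ (2 * γ + K) * driftConst momentum R η₀ β :=
      mul_nonneg (by positivity) hDnn
    have hprod7 : 0 ≤ K * (Cm * X) := mul_nonneg hKpos.le hXnn
    rw [mul_assoc (4 * R / γ + 2), ← mul_div_assoc (2 * γ + K)]
    -- Take Q = (2γ + K)(P + Cm X + Y + drift). The margin lacks γP + K Cm X + γY from γS, and the
    -- norm bound P + S adds another γP; the drift term only has to be nonnegative.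
    refine sub_div_le_of_deficit hγ hR hSpos (by linarith) (hmarpos t ht.le).le (hNpos t ht.le)
      (minMargin_le_two_mul hN hn0 hk hx (W t)) (by linarith) ?_
    have h4 : γ * N (W t) ≤ γ * (P + S) :=
      mul_le_mul_of_nonneg_left ((hNW t).trans (add_le_add_left ht₂b _)) hγ.le
    linarith
  refine ⟨fun t ht => ⟨?_, ?_, hmain t ht⟩, ?_⟩
  · rw [le_div_iff₀ hnR, mul_comm]
    exact (hLsmall t ht.le).trans (by linarith [Real.log_two_gt_d9])
  · intro h0
    have h1 := hNpos t ht.le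
    have h2 : N 0 = 0 := by simpa using hN.smul 0 0
    rw [h0, h2] at h1
    exact lt_irrefl _ h1
  · have hlim := (tendsto_rate_zero (a := a) ha ha' hc hη₀ hγ
      (∑ s ∈ Finset.range t₂, η s) Cm (driftConst momentum R η₀ β) t₂).const_mul
        ((4 * R / γ + 2) * (2 * γ + K))
    have hlow := hlim.const_sub γ
    rw [mul_zero, sub_zero] at hlow
    refine tendsto_of_tendsto_of_tendsto_of_le_of_le' hlow tendsto_const_nhds ?_ ?_
    · filter_upwards [eventually_gt_atTop t₂] with t ht
      have := hmain t ht
      linarith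
    · filter_upwards [eventually_ge_atTop t₂] with t ht
      rw [← hmar]
      exact minMargin_div_le_maxMargin hN hn0 hk hR.le hx (hNpos t ht)
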